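/- Let $(M,h)$ be a smooth finite-dimensional Riemannian manifold (Hausdorff, without boundary) and let $W$ be a smooth vector field on $M$ (the wind) with $|W|<1$. All curves are piecewise $C^1$, and conditions on velocities are understood at the parameters where the velocity exists. An admissible trajectory of the Zermelo navigation problem is a curve $\gamma$ with $\dot\gamma = W(\gamma)+C$, where $|C|\le 1$. A curve $q$ on an open interval $J$ is locally time-minimising if every $c\in J$ has a compact interval $[c-\delta,c+\delta]\subset J$, $\delta>0$, on which $q$ is an admissible trajectory and such that no admissible trajectory travels from $q(c-\delta)$ to $q(c+\delta)$ in a time less than $2\delta$. For a function $F(x,v)$ on $TM$, the curve $q$ is an $F$-geodesic on $J$ if every $c\in J$ has such an interval on which $q$ minimises $\int F(q,\dot q)\,ds$ among all curves on this interval with the same end points (no parametrisation is prescribed). A Riemannian geodesic is an $F$-geodesic for $F(x,v)=|v|$, and a Randers geodesic is an $F$-geodesic for $$F(x,v)=\frac{-h(v,W)+\sqrt{h(v,W)^2+|v|^2(1-|W|^2)}}{1-|W|^2}.$$ Flows are the maximal local flows. **Theorem.** Suppose that $W$ is an infinitesimal homothety, i.e. $\mathcal L_W h=\sigma h$ with $\sigma$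 constant, and let $\varepsilon>0$. Write $\varphi$ for the flow of $-W$ and $\varphi^{-1}$ for the flow of $W$. 1. Let $q:(-\varepsilon,\varepsilon)\to M$ be locally time-minimising. Then $p(t)=\varphi(t,q(t))$ is defined for all $|t|<r$ for some $r\in(0,\varepsilon]$, and for every $r\in(0,\varepsilon]$ for which it is defined for all $|t|<r$, $p$ is a Riemannian geodesic on $(-r,r)$, with speed $|\dot p(t)|=e^{-\sigma t/2}$. 2. Conversely, let $p:(-\varepsilon,\varepsilon)\to M$ be a Riemannian geodesic parametrised so that $|\dot p(t)|=e^{-\sigma t/2}$. Then $q(t)=\varphi^{-1}(t,p(t))$ is defined for all $|t|<r$ for some $r\in(0,\varepsilon]$, and for every $r\in(0,\varepsilon]$ for which it is defined for all $|t|<r$, $q$ is locally time-minimising on $(-r,r)$. 3. A curve $q:(-\varepsilon,\varepsilon)\to M$ is locally time-minimising if and only if it is a Randers geodesic in physical parametrisation, i.e. with $F(q,\dot q)=1$. -/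

import Mathlib

open Bundle
open scoped Manifold ContDiff

noncomputable section

namespace Zermelo

variable {E : Type*} [NormedAddCommGroup E] [NormedSpace ℝ E]
  {M : Type*} [TopologicalSpace M] [ChartedSpace E M]

/-- The velocity `γ'(t)` of a curve in `M`, a tangent vector at `γ t`. -/
def velocity (γ : ℝ → M) (t : ℝ) : TangentSpace 𝓘(ℝ, E) (γ t) :=
  mfderiv 𝓘(ℝ, ℝ) 𝓘(ℝ, E) γ t (1 : ℝ)

variable (E) in
/-- `γ` is piecewise `C^1` on the compact interval `[a, b]`: the interval is cut into finitely many
consecutive compact intervals on each of which `γ` is `C^1` up to the end points. -/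
inductive IsPiecewiseC1 (γ : ℝ → M) : ℝ → ℝ → Prop
  | piece {a b : ℝ} (hab : a ≤ b)
      (h : ContMDiffOn 𝓘(ℝ, ℝ) 𝓘(ℝ, E) 1 γ (Set.Icc a b)) : IsPiecewiseC1 γ a b
  | append {a b c : ℝ} (h₁ : IsPiecewiseC1 γ a b) (h₂ : IsPiecewiseC1 γ b c) : IsPiecewiseC1 γ a c

/-! ### Length and geodesics for a function `F` on the tangent bundle -/

/-- The length `∫ₐᵇ F(γ(s), γ'(s)) ds`. A piecewise `C^1` curve has a velocity at all but finitely
many parameters. -/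
def length (F : (x : M) → TangentSpace 𝓘(ℝ, E) x → ℝ) (γ : ℝ → M) (a b : ℝ) : ℝ :=
  ∫ s in a..b, F (γ s) (velocity γ s)

/-- The restriction of `γ` to `[a, b]` minimises `F`-length among all piecewise `C^1` curves
defined on `[a, b]` with the same end points. -/
def IsLengthMinimizing (F : (x : M) → TangentSpace 𝓘(ℝ, E) x → ℝ) (γ : ℝ → M) (a b : ℝ) : Prop :=
  IsPiecewiseC1 E γ a b ∧
    ∀ η : ℝ → M, IsPiecewiseC1 E η a b → η a = γ a → η b = γ b → length F γ a b ≤ length F η a b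

/-- `γ`, defined on the open interval `J`, locally minimises `F`-length. No parametrisation is
prescribed. -/
def IsGeodesicOn (F : (x : M) → TangentSpace 𝓘(ℝ, E) x → ℝ) (γ : ℝ → M) (J : Set ℝ) : Prop :=
  ∀ c ∈ J, ∃ δ > 0, Set.Icc (c - δ) (c + δ) ⊆ J ∧ IsLengthMinimizing F γ (c - δ) (c + δ)

/-- `γ` has `F`-speed `f t` at every parameter `t` of `J` at which it has a velocity. -/
def HasSpeedOn (F : (x : M) → TangentSpace 𝓘(ℝ, E) x → ℝ) (γ : ℝ → M) (f : ℝ → ℝ)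
    (J : Set ℝ) : Prop :=
  ∀ t ∈ J, MDifferentiableAt 𝓘(ℝ, ℝ) 𝓘(ℝ, E) γ t → F (γ t) (velocity γ t) = f t

/-! ### The flow of a vector field -/

/-- The domain of the (maximal) flow of `V`: the pairs `(t, x)` such that the integral curve of `V`
that is at `x` at time `0` exists up to and including time `t`. -/
def flowDomain (V : (x : M) → TangentSpace 𝓘(ℝ, E) x) : Set (ℝ × M) :=
  {z | ∃ γ : ℝ → M, γ 0 = z.2 ∧
    ∃ a b : ℝ, 0 ∈ Set.Ioo a b ∧ z.1 ∈ Set.Ioo a b ∧ IsMIntegralCurveOn γ V (Set.Ioo a b)}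

open Classical in
/-- The flow of `V`: `flow V t x` is the position at time `t` of the integral curve of `V` that is
at `x` at time `0`. Outside the flow domain the value is irrelevant. -/
def flow (V : (x : M) → TangentSpace 𝓘(ℝ, E) x) (t : ℝ) (x : M) : M :=
  if h : (t, x) ∈ flowDomain V then h.choose t else x

/-- The derivative `W f` of a function `f` along the vector field `W`. -/
def derivAlong (W : (x : M) → TangentSpace 𝓘(ℝ, E) x) (f : M → ℝ) (x : M) : ℝ :=
  mfderiv 𝓘(ℝ, E) 𝓘(ℝ, ℝ) f x (W x)

variable [RiemannianBundle (fun x : M ↦ TangentSpace 𝓘(ℝ, E) x)]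

/-! ### The Riemannian metric and infinitesimal homotheties -/

/-- The Riemannian norm `|v| = √(h(v, v))`. -/
def riemannNorm (x : M) (v : TangentSpace 𝓘(ℝ, E) x) : ℝ := ‖v‖

/-- The Lie derivative of the metric `h` along `W`, evaluated at `x` on the vector fields `X`, `Y`:
`(L_W h)(X, Y) = W (h(X, Y)) - h([W, X], Y) - h(X, [W, Y])`. -/
def lieDerivMetric (W X Y : (x : M) → TangentSpace 𝓘(ℝ, E) x) (x : M) : ℝ :=
  derivAlong W (fun y ↦ inner ℝ (X y) (Y y)) x
    - inner ℝ (VectorField.mlieBracket 𝓘(ℝ, E) W X x) (Y x)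
    - inner ℝ (X x) (VectorField.mlieBracket 𝓘(ℝ, E) W Y x)

variable [IsManifold 𝓘(ℝ, E) ∞ M]

/-- `W` is an infinitesimal homothety with constant `σ`: `L_W h = σ h`, tested at each point `x`
on all vector fields that are smooth at `x`. -/
def IsInfinitesimalHomothety (W : (x : M) → TangentSpace 𝓘(ℝ, E) x)
    (σ : ℝ) : Prop :=
  ∀ (x : M) (X Y : (x : M) → TangentSpace 𝓘(ℝ, E) x),
    ContMDiffAt 𝓘(ℝ, E) 𝓘(ℝ, E).tangent ∞ (fun y ↦ (⟨y, X y⟩ : TangentBundle 𝓘(ℝ, E) M)) x →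
    ContMDiffAt 𝓘(ℝ, E) 𝓘(ℝ, E).tangent ∞ (fun y ↦ (⟨y, Y y⟩ : TangentBundle 𝓘(ℝ, E) M)) x →
    lieDerivMetric W X Y x = σ * inner ℝ (X x) (Y x)

/-! ### The Zermelo navigation problem with wind `W` -/

/-- The restriction of `γ` to the time interval `[a, b]` is an admissible trajectory: `γ' = W + C`
where the control `C` satisfies `|C| ≤ 1` (the maximum speed is `1` if wind is absent). -/
def IsTrajectory (W : (x : M) → TangentSpace 𝓘(ℝ, E) x) (γ : ℝ → M) (a b : ℝ) : Prop :=
  IsPiecewiseC1 E γ a b ∧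
    ∀ t ∈ Set.Ioo a b, MDifferentiableAt 𝓘(ℝ, ℝ) 𝓘(ℝ, E) γ t → ‖velocity γ t - W (γ t)‖ ≤ 1

/-- The restriction of `q` to `[a, b]` solves the Zermelo problem between `q a` and `q b`: no
admissible trajectory travels from `q a` to `q b` in a time `T` shorter than `b - a`. -/
def IsTimeMinimizing (W : (x : M) → TangentSpace 𝓘(ℝ, E) x) (q : ℝ → M) (a b : ℝ) : Prop :=
  IsTrajectory W q a b ∧
    ∀ (T : ℝ) (γ : ℝ → M), IsTrajectory W γ 0 T → γ 0 = q a → γ T = q b → b - a ≤ T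

/-- `q`, defined on the open interval `J`, locally minimises travel time. -/
def IsLocallyTimeMinimizingOn (W : (x : M) → TangentSpace 𝓘(ℝ, E) x) (q : ℝ → M)
    (J : Set ℝ) : Prop :=
  ∀ c ∈ J, ∃ δ > 0, Set.Icc (c - δ) (c + δ) ⊆ J ∧ IsTimeMinimizing W q (c - δ) (c + δ)

/-- The Randers metric
`F(x, v) = (-h(v, W) + √(h(v, W)² + |v|² (1 - |W|²))) / (1 - |W|²)` of the wind `W`. -/
def randers (W : (x : M) → TangentSpace 𝓘(ℝ, E) x) (x : M) (v : TangentSpace 𝓘(ℝ, E) x) : ℝ :=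
  (-inner ℝ v (W x) + √((inner ℝ v (W x)) ^ 2 + ‖v‖ ^ 2 * (1 - ‖W x‖ ^ 2))) / (1 - ‖W x‖ ^ 2)

end Zermelo

end

/-!
In a frame that drifts with the wind, the control `C` of an admissible trajectory is the velocity.
Precisely, let `ψ` be the flow of `W` and `q t = ψ t (p t)`. Then `q' = W(q) + dψ_t(p')`
(`velocity_flow`), and `dψ_t` multiplies lengths by `e ^ (σ t / 2)` when `W` is an infinitesimal
homothety (`norm_mfderiv_flow`, obtained by integrating `d/dt |dψ_t v|² = σ |dψ_t v|²`). Hence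
`|p'| = e ^ (-σ t / 2) |q' - W(q)|` (`IsDragged.norm_velocity`): admissible trajectories `q` are the
curves `p` with speed at most `e ^ (-σ t / 2)`, a bound that depends only on the time.

*Randers geodesics* (`isLocallyTimeMinimizingOn_iff`). The unit ball of the Randers norm is the unit
ball of `h` shifted by `W`, so admissible means `F(q, q') ≤ 1`. A curve of `F`-length `L` can be run
through admissibly in any time greater than `L` (`IsPiecewiseC1.joins_length`), so the least travel
time is the least `F`-length. A time-minimising curve on `[a, b]` has therefore `F`-length `b - a`,
and as `F(q, q') ≤ 1` and the velocity is continuous on each piece, `F(q, q') = 1`.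

*From time-minimising to length-minimising* (`IsDragged.exists_isLengthMinimizing`). If a curve with
the end points of `p` on `[a, b]` were shorter than `p`, it could be run through with speed at most
`e ^ (-σ t / 2)`, arriving at `p b` at a time `b' < b`. Dragged by the wind, this is an admissible
trajectory from `q a` to `ψ b' (p b)`. From there the integral curve of `W` leads to
`q b = ψ b (p b)`, and it may be followed at double speed because `|W| < 1`. So `q b` is reached
before the time `b`.

*From length-minimising to time-minimising* (`IsDragged.exists_isTimeMinimizing`). A trajectory that
arrives at `q b` at a time `b' < b` may wait there, with control `-W`, until the time `b`. In the
drifting frame this gives a curve with the end points of `p` whose speed is at most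
`e ^ (-σ t / 2)`, and at most `|W(q b)| e ^ (-σ t / 2)` on `[b', b]`. It is shorter than `p`.

Since `W` need not be complete, the competing curves have to stay where the flow is defined. This
holds on short intervals: the flow domain is open (`isOpen_flowDomain`), and short curves stay near
their initial point (`exists_forall_mem_of_length_lt`). The joint differentiability of the flow
(`contMDiffAt_flow`) is deduced from that of the local flow of an ordinary differential equation
(`ODE.exists_contDiffOn_localFlow`).
-/

set_option linter.unusedSectionVars false

/-! ### Differentiability of the local flow of an ordinary differential equation -/

section

open Set Filter Metric
open scoped Topology NNReal

namespace ODE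

variable {E : Type*} [NormedAddCommGroup E] [NormedSpace ℝ E]

/-- Grönwall's inequality for a function vanishing at `0`, in both directions of time. -/
lemma norm_le_of_norm_deriv_le_of_eq_zero {e e' : ℝ → E} {δ K c : ℝ} (hK : 0 < K)
    (he : ∀ s ∈ Ioo (-δ) δ, HasDerivAt e (e' s) s) (he0 : e 0 = 0)
    (hb : ∀ s ∈ Ioo (-δ) δ, ‖e' s‖ ≤ K * ‖e s‖ + c) {t : ℝ} (ht : t ∈ Ioo (-δ) δ) :
    ‖e t‖ ≤ c * (Real.exp (K * |t|) - 1) / K := by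
  have key : ∀ (g g' : ℝ → E), (∀ s ∈ Ioo (-δ) δ, HasDerivAt g (g' s) s) → g 0 = 0 →
      (∀ s ∈ Ioo (-δ) δ, ‖g' s‖ ≤ K * ‖g s‖ + c) → ∀ u ∈ Ioo (-δ) δ, 0 ≤ u →
      ‖g u‖ ≤ c * (Real.exp (K * u) - 1) / K := by
    intro g g' hg hg0 hgb u hu hu0
    have hsub : ∀ s ∈ Icc 0 u, s ∈ Ioo (-δ) δ := fun s hs ↦
      ⟨by linarith [hs.1, hu.2], by linarith [hs.2, hu.2]⟩
    have := norm_le_gronwallBound_of_norm_deriv_right_le (f := g) (f' := g') (δ := 0) (K := K)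
      (ε := c) (a := 0) (b := u) (fun s hs ↦ (hg s (hsub s hs)).continuousAt.continuousWithinAt)
      (fun s hs ↦ (hg s (hsub s (Ico_subset_Icc_self hs))).hasDerivWithinAt) (by simp [hg0])
      (fun s hs ↦ hgb s (hsub s (Ico_subset_Icc_self hs))) u ⟨hu0, le_rfl⟩
    rw [gronwallBound_of_K_ne_0 hK.ne'] at this
    simp only [zero_mul, zero_add, sub_zero] at this
    calc _ ≤ _ := this
      _ = _ := by ring
  rcases le_total 0 t with h | h
  · rw [abs_of_nonneg h]
    exact key e e' he he0 hb t ht h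
  · rw [abs_of_nonpos h]
    have hneg : ∀ s ∈ Ioo (-δ) δ, -s ∈ Ioo (-δ) δ := fun s hs ↦
      ⟨by linarith [hs.2], by linarith [hs.1]⟩
    have := key (fun s ↦ e (-s)) (fun s ↦ -e' (-s)) (fun s hs ↦ by
      have h1 := (he (-s) (hneg s hs)).scomp s (hasDerivAt_neg s)
      simpa [Function.comp_def] using h1)
      (by simpa using he0) (fun s hs ↦ by simpa using hb (-s) (hneg s hs)) (-t) (hneg t ht)
      (by linarith)
    simpa using this

set_option maxHeartbeats 800000 in
/-- A `C²` vector field has, near each point, a local flow `φ` that is jointly `C¹`; its derivative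
`Y` in the initial point solves the linearised equation. -/
theorem exists_contDiffOn_localFlow [CompleteSpace E] {f : E → E} {x₀ : E}
    (hf : ContDiffAt ℝ 2 f x₀) {U : Set E} (hU : U ∈ 𝓝 x₀) :
    ∃ δ > 0, ∃ r > 0, ∃ (φ : ℝ → E → E) (Y : ℝ → E → E →L[ℝ] E),
      (∀ x ∈ ball x₀ r, φ 0 x = x ∧ Y 0 x = ContinuousLinearMap.id ℝ E ∧
        ∀ t ∈ Ioo (-δ) δ, φ t x ∈ U ∧ HasDerivAt (φ · x) (f (φ t x)) t ∧
          HasDerivAt (Y · x) ((fderiv ℝ f (φ t x)).comp (Y t x)) t ∧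
          HasFDerivAt (φ t) (Y t x) x) ∧
      ContDiffOn ℝ 1 (Function.uncurry φ) (Ioo (-δ) δ ×ˢ ball x₀ r) := by
  classical
  have hDf : ContDiffAt ℝ 1 (fderiv ℝ f) x₀ := hf.fderiv_right (by norm_num)
  -- the vector field and its linearisation, solved simultaneously
  let g : E × (E →L[ℝ] E) → E × (E →L[ℝ] E) := fun z ↦ (f z.1, (fderiv ℝ f z.1).comp z.2)
  have hg : ContDiffAt ℝ 1 g (x₀, ContinuousLinearMap.id ℝ E) := by
    have h1 : ContDiffAt ℝ 1 (fun z : E × (E →L[ℝ] E) ↦ f z.1) (x₀, ContinuousLinearMap.id ℝ E) :=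
      ContDiffAt.comp (g := f) _ (hf.of_le (by norm_num)) contDiffAt_fst
    have h2 : ContDiffAt ℝ 1 (fun z : E × (E →L[ℝ] E) ↦ fderiv ℝ f z.1)
        (x₀, ContinuousLinearMap.id ℝ E) :=
      ContDiffAt.comp (g := fderiv ℝ f) _ hDf contDiffAt_fst
    exact h1.prodMk (h2.clm_comp contDiffAt_snd)
  obtain ⟨ε, hε, a, r₀, _, _, hr₀, hpl⟩ := IsPicardLindelof.of_contDiffAt_one hg
  obtain ⟨α, hα, L', hL'⟩ := (hpl 0).exists_forall_mem_closedBall_eq_hasDerivWithinAt_lipschitzOnWith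
  have hcont : ContinuousOn (Function.uncurry α)
      (closedBall (x₀, ContinuousLinearMap.id ℝ E) r₀ ×ˢ Icc (0 - ε) (0 + ε)) :=
    continuousOn_prod_of_continuousOn_lipschitzOnWith _ L'
      (fun x hx ↦ HasDerivWithinAt.continuousOn (hα x hx).2) hL'
  -- a ball on which all the estimates hold
  obtain ⟨Kf, s, hs, hlip⟩ := hDf.exists_lipschitzOnWith
  have hdiff : ∀ᶠ x in 𝓝 x₀, DifferentiableAt ℝ f x :=
    (hf.eventually (by simp)).mono fun x hx ↦ hx.differentiableAt (by norm_num)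
  have hbdd : ∀ᶠ x in 𝓝 x₀, ‖fderiv ℝ f x‖ < ‖fderiv ℝ f x₀‖ + 1 :=
    hDf.continuousAt.norm.eventually_lt continuousAt_const (by simp)
  have hfcont : ∀ᶠ x in 𝓝 x₀, ContinuousAt (fderiv ℝ f) x :=
    (hDf.eventually (by simp)).mono fun x hx ↦ hx.continuousAt
  obtain ⟨ρ, hρ, hball⟩ := Metric.eventually_nhds_iff_ball.1
    ((((eventually_mem_set.2 hs).and hdiff).and hbdd).and
      ((eventually_mem_set.2 hU).and hfcont))
  set K : ℝ := ‖fderiv ℝ f x₀‖ + 1 with hKdef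
  have hK : 0 < K := by positivity
  -- a small domain, on which the solutions stay in this ball
  have hα0 : α (x₀, ContinuousLinearMap.id ℝ E) 0 = (x₀, ContinuousLinearMap.id ℝ E) :=
    (hα _ (mem_closedBall_self r₀.2)).1
  have hcont0 : ContinuousAt (Function.uncurry α) ((x₀, ContinuousLinearMap.id ℝ E), 0) :=
    hcont.continuousAt (prod_mem_nhds (closedBall_mem_nhds _ hr₀)
      (Icc_mem_nhds (by linarith) (by linarith)))
  have hcont1 : ContinuousAt (fun z : ℝ × E ↦ (α (z.2, ContinuousLinearMap.id ℝ E) z.1).1)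
      (0, x₀) := by
    have h1 : ContinuousAt (fun z : ℝ × E ↦ ((z.2, ContinuousLinearMap.id ℝ E), z.1)) (0, x₀) := by
      fun_prop
    exact continuousAt_fst.comp
      (ContinuousAt.comp (g := Function.uncurry α) (x := ((0 : ℝ), x₀)) hcont0 h1)
  have hev : ∀ᶠ z : ℝ × E in 𝓝 (0, x₀), (α (z.2, ContinuousLinearMap.id ℝ E) z.1).1 ∈ ball x₀ ρ :=
    hcont1.eventually_mem (by simpa [hα0] using ball_mem_nhds x₀ hρ)
  obtain ⟨η, hη, hηball⟩ := Metric.eventually_nhds_iff_ball.1 hev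
  set δ := min ε η
  set r := min (r₀ : ℝ) η
  have hδ : 0 < δ := lt_min hε hη
  have hr : 0 < r := lt_min hr₀ hη
  let φ : ℝ → E → E := fun t x ↦ (α (x, ContinuousLinearMap.id ℝ E) t).1
  let Y : ℝ → E → E →L[ℝ] E := fun t x ↦ (α (x, ContinuousLinearMap.id ℝ E) t).2
  have hmem : ∀ x ∈ ball x₀ r, (x, ContinuousLinearMap.id ℝ E) ∈
      closedBall (x₀, ContinuousLinearMap.id ℝ E) (r₀ : ℝ) := by
    intro x hx
    simp only [mem_closedBall, Prod.dist_eq, dist_self]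
    exact max_le ((mem_ball.1 hx).le.trans (min_le_left _ _)) r₀.2
  have htime : ∀ t ∈ Ioo (-δ) δ, t ∈ Ioo (-ε) ε := fun t ht ↦
    ⟨by linarith [ht.1, min_le_left ε η], by linarith [ht.2, min_le_left ε η]⟩
  have hφball : ∀ t ∈ Ioo (-δ) δ, ∀ x ∈ ball x₀ r, φ t x ∈ ball x₀ ρ := by
    intro t ht x hx
    refine hηball (t, x) ?_
    rw [mem_ball, Prod.dist_eq]
    refine max_lt ?_ ((mem_ball.1 hx).trans_le (min_le_right _ _))
    rw [Real.dist_eq, sub_zero, abs_lt]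
    exact ⟨by linarith [ht.1, min_le_right ε η], by linarith [ht.2, min_le_right ε η]⟩
  have hderiv : ∀ t ∈ Ioo (-δ) δ, ∀ x ∈ ball x₀ r,
      HasDerivAt (α (x, ContinuousLinearMap.id ℝ E)) (g (φ t x, Y t x)) t := by
    intro t ht x hx
    have h1 := htime t ht
    exact ((hα _ (hmem x hx)).2 t ⟨by linarith [h1.1], by linarith [h1.2]⟩).hasDerivAt
      (Icc_mem_nhds (by linarith [h1.1]) (by linarith [h1.2]))
  have hφd : ∀ t ∈ Ioo (-δ) δ, ∀ x ∈ ball x₀ r, HasDerivAt (φ · x) (f (φ t x)) t :=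
    fun t ht x hx ↦ (hderiv t ht x hx).fst
  have hYd : ∀ t ∈ Ioo (-δ) δ, ∀ x ∈ ball x₀ r,
      HasDerivAt (Y · x) ((fderiv ℝ f (φ t x)).comp (Y t x)) t :=
    fun t ht x hx ↦ (hderiv t ht x hx).snd
  have hφ0 : ∀ x ∈ ball x₀ r, φ 0 x = x := fun x hx ↦ by
    simp only [φ, (hα _ (hmem x hx)).1]
  have hY0 : ∀ x ∈ ball x₀ r, Y 0 x = ContinuousLinearMap.id ℝ E := fun x hx ↦ by
    simp only [Y, (hα _ (hmem x hx)).1]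
  have hφlip : ∀ t ∈ Ioo (-δ) δ, ∀ x ∈ ball x₀ r, ∀ y ∈ ball x₀ r,
      ‖φ t y - φ t x‖ ≤ L' * ‖y - x‖ := by
    intro t ht x hx y hy
    have h1 := htime t ht
    have := (hL' t ⟨by linarith [h1.1], by linarith [h1.2]⟩).norm_sub_le (hmem y hy) (hmem x hx)
    refine (norm_fst_le _).trans (this.trans_eq ?_)
    simp [Prod.norm_def]
  -- The error of the first order approximation solves the linearised equation up to a term that is
  -- quadratic in `y - x`, so it is itself quadratic by Grönwall's inequality.
  have hfd : ∀ t ∈ Ioo (-δ) δ, ∀ x ∈ ball x₀ r, HasFDerivAt (φ t) (Y t x) x := by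
    intro t ht x hx
    have hest : ∀ y ∈ ball x₀ r, ‖φ t y - φ t x - Y t x (y - x)‖ ≤
        (Kf * (L' * ‖y - x‖) * (L' * ‖y - x‖)) * (Real.exp (K * |t|) - 1) / K := by
      intro y hy
      refine norm_le_of_norm_deriv_le_of_eq_zero (e := fun s ↦ φ s y - φ s x - Y s x (y - x))
        (e' := fun s ↦ f (φ s y) - f (φ s x) - (fderiv ℝ f (φ s x)).comp (Y s x) (y - x))
        hK (fun s hs ↦ ?_) ?_ (fun s hs ↦ ?_) ht
      · exact ((hφd s hs y hy).sub (hφd s hs x hx)).sub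
          (by simpa using (hYd s hs x hx).clm_apply (hasDerivAt_const s (y - x)))
      · simp [hφ0 x hx, hφ0 y hy, hY0 x hx]
      · have h1 := hφball s hs x hx
        have h2 := hφball s hs y hy
        have htaylor : ‖f (φ s y) - f (φ s x) - fderiv ℝ f (φ s x) (φ s y - φ s x)‖ ≤
            (Kf * ‖φ s y - φ s x‖) * ‖φ s y - φ s x‖ := by
          refine (convex_segment (𝕜 := ℝ) (φ s x) (φ s y)).norm_image_sub_le_of_norm_hasFDerivWithin_le'
            (f' := fderiv ℝ f) (fun z hz ↦ ?_) (fun z hz ↦ ?_) (left_mem_segment ..)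
            (right_mem_segment ..)
          · exact (hball z ((convex_ball x₀ ρ).segment_subset h1 h2 hz)).1.1.2.hasFDerivAt.hasFDerivWithinAt
          · have h3 := (convex_ball x₀ ρ).segment_subset h1 h2 hz
            refine (hlip.norm_sub_le (hball z h3).1.1.1 (hball _ h1).1.1.1).trans ?_
            gcongr
            obtain ⟨θ, hθ, rfl⟩ := (segment_eq_image' ℝ (φ s x) (φ s y)) ▸ hz
            simp only [add_sub_cancel_left, norm_smul, Real.norm_eq_abs, abs_of_nonneg hθ.1]
            exact mul_le_of_le_one_left (norm_nonneg _) hθ.2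
        calc ‖f (φ s y) - f (φ s x) - (fderiv ℝ f (φ s x)).comp (Y s x) (y - x)‖
            = ‖(fderiv ℝ f (φ s x)) (φ s y - φ s x - Y s x (y - x)) +
              (f (φ s y) - f (φ s x) - fderiv ℝ f (φ s x) (φ s y - φ s x))‖ := by
              congr 1
              simp only [map_sub, ContinuousLinearMap.comp_apply]
              abel
          _ ≤ K * ‖φ s y - φ s x - Y s x (y - x)‖ + (Kf * ‖φ s y - φ s x‖) * ‖φ s y - φ s x‖ := by
              refine (norm_add_le _ _).trans (add_le_add ?_ htaylor)
              exact ContinuousLinearMap.le_of_opNorm_le _ (hball _ h1).1.2.le _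
          _ ≤ K * ‖φ s y - φ s x - Y s x (y - x)‖ + Kf * (L' * ‖y - x‖) * (L' * ‖y - x‖) := by
              gcongr <;> exact hφlip s hs x hx y hy
    rw [hasFDerivAt_iff_isLittleO]
    have hO : (fun y ↦ φ t y - φ t x - Y t x (y - x)) =O[𝓝 x] fun y ↦ ‖y - x‖ ^ 2 := by
      refine Asymptotics.IsBigO.of_bound (Kf * L' * L' * (Real.exp (K * |t|) - 1) / K) ?_
      filter_upwards [isOpen_ball.mem_nhds hx] with y hy
      refine (hest y hy).trans_eq ?_
      rw [norm_pow, norm_norm]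
      ring
    refine hO.trans_isLittleO ?_
    exact Asymptotics.isLittleO_pow_sub_sub x one_lt_two
  -- Both partial derivatives are jointly continuous, hence `φ` is jointly `C¹`.
  have hopen : IsOpen (Ioo (-δ) δ ×ˢ ball x₀ r) := isOpen_Ioo.prod isOpen_ball
  have hcontα : ∀ z ∈ Ioo (-δ) δ ×ˢ ball x₀ r,
      ContinuousAt (fun z : ℝ × E ↦ α (z.2, ContinuousLinearMap.id ℝ E) z.1) z := by
    intro z hz
    have h1 : ContinuousAt (fun z : ℝ × E ↦ ((z.2, ContinuousLinearMap.id ℝ E), z.1)) z := by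
      fun_prop
    refine ContinuousAt.comp (g := Function.uncurry α) (x := z) ?_ h1
    have h2 := htime _ hz.1
    refine hcont.continuousAt (prod_mem_nhds ?_ (Icc_mem_nhds (by linarith [h2.1])
      (by linarith [h2.2])))
    refine closedBall_mem_nhds_of_mem ?_
    simp only [mem_ball, Prod.dist_eq, dist_self]
    exact max_lt ((mem_ball.1 hz.2).trans_le (min_le_left _ _)) hr₀
  let f₁ : ℝ → E → ℝ →L[ℝ] E := fun t x ↦ ContinuousLinearMap.toSpanSingleton ℝ (f (φ t x))
  have hcφ : ∀ z ∈ Ioo (-δ) δ ×ˢ ball x₀ r, ContinuousAt (fun z : ℝ × E ↦ φ z.1 z.2) z :=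
    fun z hz ↦ (hcontα z hz).fst
  have hc₁ : ∀ z ∈ Ioo (-δ) δ ×ˢ ball x₀ r, ContinuousAt (Function.uncurry f₁) z := by
    intro z hz
    have h1 : ContinuousAt f (φ z.1 z.2) := (hball _ (hφball _ hz.1 _ hz.2)).1.1.2.continuousAt
    have h2 : ContinuousAt (fun z : ℝ × E ↦ f (φ z.1 z.2)) z :=
      ContinuousAt.comp (g := f) h1 (hcφ z hz)
    exact ContinuousAt.comp (g := fun v ↦ ContinuousLinearMap.toSpanSingleton ℝ v)
      (ContinuousLinearMap.toSpanSingletonCLE (𝕜 := ℝ) (E := E)).continuous.continuousAt h2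
  have hc₂ : ∀ z ∈ Ioo (-δ) δ ×ˢ ball x₀ r, ContinuousAt (Function.uncurry Y) z :=
    fun z hz ↦ (hcontα z hz).snd
  have hstrict : ∀ z ∈ Ioo (-δ) δ ×ˢ ball x₀ r,
      HasFDerivAt (Function.uncurry φ) ((Function.uncurry f₁ z).coprod (Function.uncurry Y z)) z := by
    intro z hz
    refine (hasStrictFDerivAt_uncurry_coprod (f := φ) (f₁ := f₁) (f₂ := Y) ?_ ?_ (hc₁ z hz)
      (hc₂ z hz)).hasFDerivAt
    · filter_upwards [hopen.mem_nhds hz] with v hv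
      exact (hφd _ hv.1 _ hv.2).hasFDerivAt
    · filter_upwards [hopen.mem_nhds hz] with v hv
      exact hfd _ hv.1 _ hv.2
  refine ⟨δ, hδ, r, hr, φ, Y, fun x hx ↦ ⟨hφ0 x hx, hY0 x hx, fun t ht ↦
    ⟨(hball _ (hφball t ht x hx)).2.1, hφd t ht x hx, hYd t ht x hx, hfd t ht x hx⟩⟩, ?_⟩
  intro z hz
  refine (contDiffAt_one_iff.2 ⟨_, _, hopen.mem_nhds hz, ?_, hstrict⟩).contDiffWithinAt
  intro w hw
  refine ContinuousAt.continuousWithinAt ?_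
  exact ContinuousAt.comp (g := fun p : (ℝ →L[ℝ] E) × (E →L[ℝ] E) ↦ p.1.coprod p.2)
    (ContinuousLinearMap.coprodEquivL (𝕜 := ℝ) ℝ (E := ℝ) (F := E) (G := E)).continuous.continuousAt
    ((hc₁ w hw).prodMk (hc₂ w hw))

end ODE

end

/-! ### The maximal flow of a vector field -/

section

open Set Filter
open scoped Topology

namespace Zermelo

variable {E : Type*} [NormedAddCommGroup E] [NormedSpace ℝ E] [FiniteDimensional ℝ E]
  {M : Type*} [TopologicalSpace M] [ChartedSpace E M] [IsManifold 𝓘(ℝ, E) ∞ M]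
  {W : (x : M) → TangentSpace 𝓘(ℝ, E) x}

lemma flow_zero (x : M) : flow W 0 x = x := by
  rw [flow]
  split_ifs with h
  · exact h.choose_spec.1
  · rfl

section Unique

variable [T2Space M]

lemma flow_eq_of_isMIntegralCurveOn
    (hW : ContMDiff 𝓘(ℝ, E) 𝓘(ℝ, E).tangent ∞ (fun x ↦ (⟨x, W x⟩ : TangentBundle 𝓘(ℝ, E) M)))
    {γ : ℝ → M} {a b : ℝ} (h0 : 0 ∈ Ioo a b) (hγ : IsMIntegralCurveOn γ W (Ioo a b))
    {t : ℝ} (ht : t ∈ Ioo a b) : flow W t (γ 0) = γ t := by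
  have h : (t, γ 0) ∈ flowDomain W := ⟨γ, rfl, a, b, h0, ht, hγ⟩
  rw [flow, dif_pos h]
  obtain ⟨h1, a', b', h0', ht', hγ'⟩ := h.choose_spec
  have : EqOn h.choose γ (Ioo (max a a') (min b b')) :=
    isMIntegralCurveOn_Ioo_eqOn_of_contMDiff_boundaryless (t₀ := 0)
      ⟨max_lt h0.1 h0'.1, lt_min h0.2 h0'.2⟩ (hW.of_le (by simp))
      (hγ'.mono (Ioo_subset_Ioo (le_max_right _ _) (min_le_right _ _)))
      (hγ.mono (Ioo_subset_Ioo (le_max_left _ _) (min_le_left _ _))) h1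
  exact this ⟨max_lt ht.1 ht'.1, lt_min ht.2 ht'.2⟩

/-- The integral curve through `x` that exists up to time `t` is `s ↦ flow W s x`. -/
lemma exists_isMIntegralCurveOn_flow
    (hW : ContMDiff 𝓘(ℝ, E) 𝓘(ℝ, E).tangent ∞ (fun x ↦ (⟨x, W x⟩ : TangentBundle 𝓘(ℝ, E) M)))
    {t : ℝ} {x : M} (h : (t, x) ∈ flowDomain W) :
    ∃ a b : ℝ, 0 ∈ Ioo a b ∧ t ∈ Ioo a b ∧ IsMIntegralCurveOn (flow W · x) W (Ioo a b) := by
  obtain ⟨γ, h1, a, b, h0, ht, hγ⟩ := h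
  dsimp only at h1 ht
  subst h1
  refine ⟨a, b, h0, ht, ?_⟩
  intro s hs
  have h2 : ∀ u ∈ Ioo a b, flow W u (γ 0) = γ u := fun u hu ↦
    flow_eq_of_isMIntegralCurveOn hW h0 hγ hu
  have h3 := hγ s hs
  have h4 := h3.congr_of_eventuallyEq (eventually_of_mem self_mem_nhdsWithin h2) (h2 s hs)
  rw [← h2 s hs] at h4
  exact h4

lemma mem_flowDomain_of_isMIntegralCurveOn {γ : ℝ → M} {a b : ℝ}
    (hγ : IsMIntegralCurveOn γ W (Ioo a b)) {s t : ℝ} (hs : s ∈ Ioo a b) (ht : s + t ∈ Ioo a b) :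
    (t, γ s) ∈ flowDomain W ∧
      IsMIntegralCurveOn (γ ∘ (· + s)) W (Ioo (a - s) (b - s)) := by
  have h1 := hγ.comp_add s
  have h2 : {u : ℝ | u + s ∈ Ioo a b} = Ioo (a - s) (b - s) := by
    ext u; simp only [mem_ofPred_eq, mem_Ioo]; constructor <;> rintro ⟨h, h'⟩ <;> constructor <;> linarith
  rw [h2] at h1
  refine ⟨⟨γ ∘ (· + s), by simp, a - s, b - s, ⟨by linarith [hs.1], by linarith [hs.2]⟩,
    ⟨by linarith [ht.1], by linarith [ht.2]⟩, h1⟩, h1⟩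

/-- The group law. The integral curves through `x` and through `flow W s x` are glued, so that
`(s + t, x)` belongs to the flow domain as soon as both steps are possible. -/
lemma flow_add
    (hW : ContMDiff 𝓘(ℝ, E) 𝓘(ℝ, E).tangent ∞ (fun x ↦ (⟨x, W x⟩ : TangentBundle 𝓘(ℝ, E) M)))
    {s t : ℝ} {x : M} (hs : (s, x) ∈ flowDomain W) (ht : (t, flow W s x) ∈ flowDomain W) :
    (s + t, x) ∈ flowDomain W ∧ flow W (s + t) x = flow W t (flow W s x) := by
  classical
  obtain ⟨a, b, h0, hsab, hγ⟩ := exists_isMIntegralCurveOn_flow hW hs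
  obtain ⟨a', b', h0', htab, hγ'⟩ := exists_isMIntegralCurveOn_flow hW ht
  set y := flow W s x with hy
  have h1 : IsMIntegralCurveOn ((flow W · y) ∘ (· - s)) W (Ioo (a' + s) (b' + s)) := by
    have h1 := hγ'.comp_add (-s)
    have h2 : {u : ℝ | u + -s ∈ Ioo a' b'} = Ioo (a' + s) (b' + s) := by
      ext u; simp only [mem_ofPred_eq, mem_Ioo]
      constructor <;> rintro ⟨h, h'⟩ <;> constructor <;> linarith
    rw [h2] at h1
    exact h1
  have hmem : s ∈ Ioo a b ∩ Ioo (a' + s) (b' + s) :=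
    ⟨hsab, by linarith [h0'.1], by linarith [h0'.2]⟩
  have heq : flow W s x = ((flow W · y) ∘ (· - s)) s := by simp [flow_zero, hy]
  have hpw := isMIntegralCurveOn_piecewise (hW.of_le (by simp)) hγ h1 hmem heq
  have hpw2 := eqOn_piecewise_of_isMIntegralCurveOn_Ioo (hW.of_le (by simp)) hγ h1 hmem heq
  set γ := piecewise (Ioo a b) (flow W · x) ((flow W · y) ∘ (· - s)) with hγdef
  have hU : Ioo a b ∪ Ioo (a' + s) (b' + s) = Ioo (min a (a' + s)) (max b (b' + s)) :=
    Ioo_union_Ioo' (hmem.2.1.trans hmem.1.2) (hmem.1.1.trans hmem.2.2)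
  rw [hU] at hpw
  have hγ0 : γ 0 = x := by rw [hγdef, piecewise_eq_of_mem _ _ _ h0, flow_zero]
  have hst : s + t ∈ Ioo (a' + s) (b' + s) := ⟨by linarith [htab.1], by linarith [htab.2]⟩
  have hst' : s + t ∈ Ioo (min a (a' + s)) (max b (b' + s)) := hU ▸ Or.inr hst
  have h00 : (0 : ℝ) ∈ Ioo (min a (a' + s)) (max b (b' + s)) := hU ▸ Or.inl h0
  refine ⟨⟨γ, hγ0, _, _, h00, hst', hpw⟩, ?_⟩
  have := flow_eq_of_isMIntegralCurveOn hW h00 hpw hst'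
  rw [hγ0, hpw2 hst] at this
  simpa using this

lemma flow_neg_flow
    (hW : ContMDiff 𝓘(ℝ, E) 𝓘(ℝ, E).tangent ∞ (fun x ↦ (⟨x, W x⟩ : TangentBundle 𝓘(ℝ, E) M)))
    {t : ℝ} {x : M} (h : (t, x) ∈ flowDomain W) :
    (-t, flow W t x) ∈ flowDomain W ∧ flow W (-t) (flow W t x) = x := by
  obtain ⟨a, b, h0, ht, hγ⟩ := exists_isMIntegralCurveOn_flow hW h
  obtain ⟨h1, h2⟩ := mem_flowDomain_of_isMIntegralCurveOn hγ (t := -t) ht (by simpa using h0)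
  refine ⟨h1, ?_⟩
  have := flow_eq_of_isMIntegralCurveOn hW (by constructor <;> linarith [ht.1, ht.2]) h2
    (t := -t) (by constructor <;> linarith [h0.1, h0.2])
  simpa [flow_zero] using this

lemma mem_flowDomain_neg_of_mem {t : ℝ} {x : M} (h : (t, x) ∈ flowDomain (-W)) :
    (-t, x) ∈ flowDomain W := by
  obtain ⟨γ, h1, a, b, h0, ht, hγ⟩ := h
  have h2 := hγ.comp_mul (-1)
  have h3 : {u : ℝ | u * -1 ∈ Ioo a b} = Ioo (-b) (-a) := by
    ext u; simp only [mem_ofPred_eq, mem_Ioo]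
    constructor <;> rintro ⟨h, h'⟩ <;> constructor <;> linarith
  rw [h3, neg_smul, one_smul, neg_neg] at h2
  dsimp only at ht
  exact ⟨_, by simpa using h1, -b, -a, by constructor <;> linarith [h0.1, h0.2],
    by constructor <;> dsimp only <;> linarith [ht.1, ht.2], h2⟩

lemma mem_flowDomain_neg {t : ℝ} {x : M} : (t, x) ∈ flowDomain (-W) ↔ (-t, x) ∈ flowDomain W := by
  refine ⟨mem_flowDomain_neg_of_mem, fun h ↦ ?_⟩
  have := mem_flowDomain_neg_of_mem (W := -W) (t := -t) (x := x) (by rwa [neg_neg])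
  rwa [neg_neg] at this

lemma flow_neg
    (hW : ContMDiff 𝓘(ℝ, E) 𝓘(ℝ, E).tangent ∞ (fun x ↦ (⟨x, W x⟩ : TangentBundle 𝓘(ℝ, E) M)))
    {t : ℝ} {x : M} (h : (-t, x) ∈ flowDomain W) : flow (-W) t x = flow W (-t) x := by
  have hd : (t, x) ∈ flowDomain (-W) := mem_flowDomain_neg.2 h
  rw [flow, dif_pos hd]
  obtain ⟨h1, a, b, h0, ht, hγ⟩ := hd.choose_spec
  set γ := hd.choose
  have h2 := hγ.comp_mul (-1)
  have h3 : {u : ℝ | u * -1 ∈ Ioo a b} = Ioo (-b) (-a) := by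
    ext u; simp only [mem_ofPred_eq, mem_Ioo]
    constructor <;> rintro ⟨h, h'⟩ <;> constructor <;> linarith
  rw [h3, neg_smul, one_smul, neg_neg] at h2
  dsimp only at ht
  have := flow_eq_of_isMIntegralCurveOn hW (by constructor <;> linarith [h0.1, h0.2]) h2 (t := -t)
    (by constructor <;> linarith [ht.1, ht.2])
  simp only [Function.comp_apply, mul_neg, mul_one, neg_neg, neg_zero] at this
  rw [← this]
  exact congrArg _ h1

end Unique

end Zermelo

end

/-! ### The local flow of a vector field in a chart -/

section

open Set Filter VectorField
open scoped Topology

namespace Zermelo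

variable {E : Type*} [NormedAddCommGroup E] [NormedSpace ℝ E] [FiniteDimensional ℝ E]
  {M : Type*} [TopologicalSpace M] [ChartedSpace E M] [IsManifold 𝓘(ℝ, E) ∞ M]
  {W : (x : M) → TangentSpace 𝓘(ℝ, E) x}

/-- The vector field `W` read in the preferred chart at `x₀`. -/
noncomputable def chartField (W : (x : M) → TangentSpace 𝓘(ℝ, E) x) (x₀ : M) : E → E :=
  mpullbackWithin 𝓘(ℝ, E) 𝓘(ℝ, E) (extChartAt 𝓘(ℝ, E) x₀).symm W (range 𝓘(ℝ, E))

lemma contDiffAt_chartField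
    (hW : ContMDiff 𝓘(ℝ, E) 𝓘(ℝ, E).tangent ∞ (fun x ↦ (⟨x, W x⟩ : TangentBundle 𝓘(ℝ, E) M)))
    (x₀ : M) : ContDiffAt ℝ ∞ (chartField W x₀) (extChartAt 𝓘(ℝ, E) x₀ x₀) := by
  have h := contMDiffWithinAt_mpullbackWithin_extChartAt_symm (n := ∞) (m := ∞) (s := univ)
    (I := 𝓘(ℝ, E)) (x := x₀) (hW x₀).contMDiffWithinAt uniqueMDiffOn_univ (mem_univ _) (by simp)
  rw [contMDiffWithinAt_vectorSpace_iff_contDiffWithinAt] at h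
  exact h.contDiffAt (by simpa using extChartAt_target_mem_nhds (I := 𝓘(ℝ, E)) x₀)

lemma mfderivWithin_symm_chartField (x₀ : M) {y : E} (hy : y ∈ (extChartAt 𝓘(ℝ, E) x₀).target) :
    mfderivWithin 𝓘(ℝ, E) 𝓘(ℝ, E) (extChartAt 𝓘(ℝ, E) x₀).symm (range 𝓘(ℝ, E)) y
      (chartField W x₀ y : E) = W ((extChartAt 𝓘(ℝ, E) x₀).symm y) := by
  have h := isInvertible_mfderivWithin_extChartAt_symm hy
  exact (h.inverse_apply_eq.1 rfl).symm

lemma hasMFDerivAt_extChartAt_symm (x₀ : M) {y : E}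
    (hy : y ∈ (extChartAt 𝓘(ℝ, E) x₀).target) :
    HasMFDerivAt 𝓘(ℝ, E) 𝓘(ℝ, E) (extChartAt 𝓘(ℝ, E) x₀).symm y
      (mfderivWithin 𝓘(ℝ, E) 𝓘(ℝ, E) (extChartAt 𝓘(ℝ, E) x₀).symm (range 𝓘(ℝ, E)) y) :=
  (mdifferentiableWithinAt_extChartAt_symm hy).hasMFDerivWithinAt.hasMFDerivAt (by simp)

/-- Near each point a smooth vector field has a local flow `Φ` that is jointly `C¹`. In the chart
at `x₀`, the derivative of `Φ t` at `x₀` solves the linearised equation. -/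
theorem exists_localFlow
    (hW : ContMDiff 𝓘(ℝ, E) 𝓘(ℝ, E).tangent ∞ (fun x ↦ (⟨x, W x⟩ : TangentBundle 𝓘(ℝ, E) M)))
    (x₀ : M) : ∃ δ > 0, ∃ N : Set M, IsOpen N ∧ x₀ ∈ N ∧ ∃ Φ : ℝ → M → M,
      (∀ x ∈ N, Φ 0 x = x ∧ IsMIntegralCurveOn (Φ · x) W (Ioo (-δ) δ)) ∧
      ContMDiffOn (𝓘(ℝ, ℝ).prod 𝓘(ℝ, E)) 𝓘(ℝ, E) 1 (Function.uncurry Φ) (Ioo (-δ) δ ×ˢ N) ∧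
      ∀ v : E, ∃ y : ℝ → E, y 0 = v ∧
        HasDerivAt y (fderiv ℝ (chartField W x₀) (extChartAt 𝓘(ℝ, E) x₀ x₀) v) 0 ∧
        ∀ t ∈ Ioo (-δ) δ, Φ t x₀ ∈ (extChartAt 𝓘(ℝ, E) x₀).source ∧
          mfderiv 𝓘(ℝ, E) 𝓘(ℝ, E) (Φ t) x₀ v =
            mfderivWithin 𝓘(ℝ, E) 𝓘(ℝ, E) (extChartAt 𝓘(ℝ, E) x₀).symm (range 𝓘(ℝ, E))
              (extChartAt 𝓘(ℝ, E) x₀ (Φ t x₀)) (y t) := by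
  have hf := (contDiffAt_chartField hW x₀).of_le (m := 2) (by norm_cast)
  set e := extChartAt 𝓘(ℝ, E) x₀ with he
  set f := chartField W x₀ with hfdef
  have htgt : IsOpen e.target := isOpen_extChartAt_target x₀
  obtain ⟨δ, hδ, r, hr, φ, Y, hφ, hsm⟩ :=
    ODE.exists_contDiffOn_localFlow hf (extChartAt_target_mem_nhds (I := 𝓘(ℝ, E)) x₀)
  set N := e.source ∩ e ⁻¹' Metric.ball (e x₀) r with hN
  have hNo : IsOpen N := (continuousOn_extChartAt x₀).isOpen_inter_preimage
    (isOpen_extChartAt_source x₀) Metric.isOpen_ball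
  have h0 : (0 : ℝ) ∈ Ioo (-δ) δ := ⟨by linarith, hδ⟩
  have hx₀N : x₀ ∈ N := ⟨mem_extChartAt_source x₀, Metric.mem_ball_self hr⟩
  refine ⟨δ, hδ, N, hNo, hx₀N, fun t x ↦ e.symm (φ t (e x)), ?_, ?_, ?_⟩
  · intro x hx
    refine ⟨by simp only [(hφ _ hx.2).1]; exact e.left_inv hx.1, fun t ht ↦ ?_⟩
    obtain ⟨h1, h2, -⟩ := (hφ _ hx.2).2.2 t ht
    have h3 := (hasMFDerivAt_extChartAt_symm x₀ h1).comp t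
      (h2.hasFDerivAt.hasMFDerivAt)
    refine HasMFDerivAt.hasMFDerivWithinAt (h3.congr_mfderiv ?_)
    refine ContinuousLinearMap.ext_ring (R₁ := ℝ) ?_
    refine (congrArg _ (one_smul ℝ (f (φ t (e x))))).trans ?_
    exact (mfderivWithin_symm_chartField x₀ h1).trans
      (one_smul ℝ (W ((extChartAt 𝓘(ℝ, E) x₀).symm (φ t (e x))))).symm
  · have h1 : ContMDiffOn (𝓘(ℝ, ℝ).prod 𝓘(ℝ, E)) 𝓘(ℝ, ℝ × E) 1 (fun z : ℝ × M ↦ (z.1, e z.2))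
        (Ioo (-δ) δ ×ˢ N) := by
      refine ContMDiffOn.prodMk_space contMDiffOn_fst ?_
      exact (contMDiffOn_extChartAt (n := 1) (x := x₀)).comp contMDiffOn_snd fun z hz ↦ by
        have := hz.2.1
        rwa [he, extChartAt_source] at this
    have h2 : ContMDiffOn (𝓘(ℝ, ℝ).prod 𝓘(ℝ, E)) 𝓘(ℝ, E) 1 (fun z : ℝ × M ↦ φ z.1 (e z.2))
        (Ioo (-δ) δ ×ˢ N) :=
      hsm.contMDiffOn.comp h1 fun z hz ↦ ⟨hz.1, hz.2.2⟩
    exact (contMDiffOn_extChartAt_symm (n := 1) x₀).comp h2 fun z hz ↦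
      ((hφ _ hz.2.2).2.2 z.1 hz.1).1
  · intro v
    obtain ⟨hp0, hY0, hp⟩ := hφ (e x₀) (Metric.mem_ball_self hr)
    refine ⟨fun t ↦ Y t (e x₀) v, by simp [hY0], ?_, fun t ht ↦ ?_⟩
    · have := (hp 0 h0).2.2.1.clm_apply (hasDerivAt_const 0 v)
      simpa [hY0, hp0] using this
    · obtain ⟨h1, -, -, h2⟩ := hp t ht
      refine ⟨e.map_target h1, ?_⟩
      have h3 : HasMFDerivAt 𝓘(ℝ, E) 𝓘(ℝ, E) e x₀ (ContinuousLinearMap.id ℝ E) := by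
        have := (mdifferentiableAt_extChartAt (I := 𝓘(ℝ, E)) (mem_chart_source E x₀)).hasMFDerivAt
        rwa [mfderiv_extChartAt_self] at this
      have h4 := (hasMFDerivAt_extChartAt_symm x₀ h1).comp x₀ (h2.hasMFDerivAt.comp x₀ h3)
      have h5 := h4.mfderiv
      have h6 : (e.symm ∘ φ t ∘ e) = fun x ↦ e.symm (φ t (e x)) := rfl
      rw [h6] at h5
      rw [h5, e.right_inv h1]
      rfl

end Zermelo

end

/-! ### Smoothness of the maximal flow -/

section

open Set Filter VectorField
open scoped Topology

namespace Zermelo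

variable {E : Type*} [NormedAddCommGroup E] [NormedSpace ℝ E] [FiniteDimensional ℝ E]
  {M : Type*} [TopologicalSpace M] [T2Space M] [ChartedSpace E M] [IsManifold 𝓘(ℝ, E) ∞ M]
  {W : (x : M) → TangentSpace 𝓘(ℝ, E) x}

lemma flow_eq_localFlow
    (hW : ContMDiff 𝓘(ℝ, E) 𝓘(ℝ, E).tangent ∞ (fun x ↦ (⟨x, W x⟩ : TangentBundle 𝓘(ℝ, E) M)))
    {δ : ℝ} {N : Set M} {Φ : ℝ → M → M}
    (hΦ : ∀ x ∈ N, Φ 0 x = x ∧ IsMIntegralCurveOn (Φ · x) W (Ioo (-δ) δ)) {t : ℝ}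
    (ht : t ∈ Ioo (-δ) δ) {x : M} (hx : x ∈ N) :
    (t, x) ∈ flowDomain W ∧ flow W t x = Φ t x := by
  obtain ⟨h1, h2⟩ := hΦ x hx
  have h0 : (0 : ℝ) ∈ Ioo (-δ) δ := ⟨by linarith [ht.1, ht.2], by linarith [ht.1, ht.2]⟩
  refine ⟨⟨_, h1, -δ, δ, h0, ht, h2⟩, ?_⟩
  have := flow_eq_of_isMIntegralCurveOn hW h0 h2 ht
  rwa [h1] at this

/-- For short times the flow is defined and `C¹` near a given point. -/
lemma exists_flow_contMDiffAt
    (hW : ContMDiff 𝓘(ℝ, E) 𝓘(ℝ, E).tangent ∞ (fun x ↦ (⟨x, W x⟩ : TangentBundle 𝓘(ℝ, E) M)))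
    (x₀ : M) : ∃ δ > 0, ∃ N : Set M, IsOpen N ∧ x₀ ∈ N ∧ ∀ t ∈ Ioo (-δ) δ, ∀ x ∈ N,
      (t, x) ∈ flowDomain W ∧
      ContMDiffAt (𝓘(ℝ, ℝ).prod 𝓘(ℝ, E)) 𝓘(ℝ, E) 1 (fun z : ℝ × M ↦ flow W z.1 z.2) (t, x) := by
  obtain ⟨δ, hδ, N, hN, hx₀, Φ, hΦ, hsm, -⟩ := exists_localFlow hW x₀
  refine ⟨δ, hδ, N, hN, hx₀, fun t ht x hx ↦ ⟨(flow_eq_localFlow hW hΦ ht hx).1, ?_⟩⟩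
  have hnhds : Ioo (-δ) δ ×ˢ N ∈ 𝓝 (t, x) := (isOpen_Ioo.prod hN).mem_nhds ⟨ht, hx⟩
  refine (hsm.contMDiffAt hnhds).congr_of_eventuallyEq ?_
  filter_upwards [hnhds] with z hz
  exact (flow_eq_localFlow hW hΦ hz.1 hz.2).2

/-- The domain of the flow is open and the flow is `C¹` on it. -/
theorem flowDomain_mem_nhds_and_contMDiffAt_flow
    (hW : ContMDiff 𝓘(ℝ, E) 𝓘(ℝ, E).tangent ∞ (fun x ↦ (⟨x, W x⟩ : TangentBundle 𝓘(ℝ, E) M)))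
    {t : ℝ} {x : M} (h : (t, x) ∈ flowDomain W) :
    flowDomain W ∈ 𝓝 (t, x) ∧
      ContMDiffAt (𝓘(ℝ, ℝ).prod 𝓘(ℝ, E)) 𝓘(ℝ, E) 1 (fun z : ℝ × M ↦ flow W z.1 z.2) (t, x) := by
  obtain ⟨a, b, h0, ht, hγ⟩ := exists_isMIntegralCurveOn_flow hW h
  -- The good times on the integral curve of `x` form an open and closed set: near `flow W τ₀ x` the
  -- flow is good for times less than some `δ`, and the group law passes on what holds at one time to
  -- all times at distance less than `δ`.
  let G : ℝ → Prop := fun τ ↦ flowDomain W ∈ 𝓝 (τ, x) ∧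
    ContMDiffAt (𝓘(ℝ, ℝ).prod 𝓘(ℝ, E)) 𝓘(ℝ, E) 1 (fun z : ℝ × M ↦ flow W z.1 z.2) (τ, x)
  have hG0 : G 0 := by
    obtain ⟨δ, hδ, N, hN, hx, h1⟩ := exists_flow_contMDiffAt hW x
    have hmem : (0 : ℝ) ∈ Ioo (-δ) δ := ⟨by linarith, hδ⟩
    exact ⟨mem_of_superset ((isOpen_Ioo.prod hN).mem_nhds ⟨hmem, hx⟩)
      fun z hz ↦ (h1 z.1 hz.1 z.2 hz.2).1, (h1 0 hmem x hx).2⟩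
  have hstep : ∀ τ₀ ∈ Ioo a b, ∀ᶠ τ in 𝓝[Ioo a b] τ₀, (G τ₀ → G τ) ∧ (G τ → G τ₀) := by
    intro τ₀ hτ₀
    obtain ⟨δ, hδ, N, hN, hx, h1⟩ := exists_flow_contMDiffAt hW (flow W τ₀ x)
    have key : ∀ τ τ', |τ' - τ| < δ → flow W τ x ∈ N → G τ → G τ' := by
      intro τ τ' hττ hτN hGτ
      have hmem : τ' - τ ∈ Ioo (-δ) δ := abs_lt.1 hττ
      have hc : ContMDiffAt (𝓘(ℝ, ℝ).prod 𝓘(ℝ, E)) 𝓘(ℝ, E) 1 (fun z : ℝ × M ↦ flow W τ z.2)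
          (τ', x) := by
        have h2 : ContMDiffAt (𝓘(ℝ, ℝ).prod 𝓘(ℝ, E)) (𝓘(ℝ, ℝ).prod 𝓘(ℝ, E)) 1
            (fun z : ℝ × M ↦ (τ, z.2)) (τ', x) := contMDiffAt_const.prodMk contMDiffAt_snd
        exact ContMDiffAt.comp (g := fun z : ℝ × M ↦ flow W z.1 z.2) (τ', x) hGτ.2 h2
      have hev : ∀ᶠ z : ℝ × M in 𝓝 (τ', x), (z.1, z.2) ∈ flowDomain W ∧
          flow W z.1 z.2 = flow W (z.1 - τ) (flow W τ z.2) := by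
        have e1 : ∀ᶠ z : ℝ × M in 𝓝 (τ', x), (τ, z.2) ∈ flowDomain W :=
          (show ContinuousAt (fun z : ℝ × M ↦ (τ, z.2)) (τ', x) by fun_prop).eventually_mem hGτ.1
        have e2 : ∀ᶠ z : ℝ × M in 𝓝 (τ', x), flow W τ z.2 ∈ N :=
          hc.continuousAt.eventually_mem (hN.mem_nhds hτN)
        have e3 : ∀ᶠ z : ℝ × M in 𝓝 (τ', x), z.1 - τ ∈ Ioo (-δ) δ :=
          (show ContinuousAt (fun z : ℝ × M ↦ z.1 - τ) (τ', x) by fun_prop).eventually_mem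
            (isOpen_Ioo.mem_nhds hmem)
        filter_upwards [e1, e2, e3] with z hz1 hz2 hz3
        have := flow_add hW hz1 (h1 _ hz3 _ hz2).1
        rwa [add_sub_cancel] at this
      refine ⟨hev.mono fun z hz ↦ hz.1, ?_⟩
      have h3 : ContMDiffAt (𝓘(ℝ, ℝ).prod 𝓘(ℝ, E)) (𝓘(ℝ, ℝ).prod 𝓘(ℝ, E)) 1
          (fun z : ℝ × M ↦ (z.1 - τ, flow W τ z.2)) (τ', x) := by
        refine ContMDiffAt.prodMk ?_ hc
        exact (contDiff_id.sub contDiff_const).contMDiff.contMDiffAt.comp (τ', x) contMDiffAt_fst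
      have h4 := ContMDiffAt.comp (g := fun z : ℝ × M ↦ flow W z.1 z.2) (τ', x)
        (h1 _ hmem _ hτN).2 h3
      exact h4.congr_of_eventuallyEq (hev.mono fun z hz ↦ hz.2)
    have hcont : ContinuousWithinAt (flow W · x) (Ioo a b) τ₀ := hγ.continuousWithinAt hτ₀
    have e1 := hcont.eventually_mem (hN.mem_nhds hx)
    have e2 : ∀ᶠ τ in 𝓝[Ioo a b] τ₀, |τ - τ₀| < δ := by
      refine nhdsWithin_le_nhds ?_
      exact Metric.ball_mem_nhds τ₀ hδ
    filter_upwards [e1, e2] with τ hτ1 hτ2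
    exact ⟨key τ₀ τ hτ2 hx, key τ τ₀ (by rwa [abs_sub_comm]) hτ1⟩
  exact isPreconnected_Ioo.induction₂' (fun τ τ' ↦ G τ → G τ') hstep
    (fun _ _ _ _ _ _ h1 h2 h3 ↦ h2 (h1 h3)) h0 ht hG0

lemma isOpen_flowDomain
    (hW : ContMDiff 𝓘(ℝ, E) 𝓘(ℝ, E).tangent ∞ (fun x ↦ (⟨x, W x⟩ : TangentBundle 𝓘(ℝ, E) M))) :
    IsOpen (flowDomain W) :=
  isOpen_iff_mem_nhds.2 fun _ hz ↦ (flowDomain_mem_nhds_and_contMDiffAt_flow hW hz).1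

lemma contMDiffAt_flow
    (hW : ContMDiff 𝓘(ℝ, E) 𝓘(ℝ, E).tangent ∞ (fun x ↦ (⟨x, W x⟩ : TangentBundle 𝓘(ℝ, E) M)))
    {t : ℝ} {x : M} (h : (t, x) ∈ flowDomain W) :
    ContMDiffAt (𝓘(ℝ, ℝ).prod 𝓘(ℝ, E)) 𝓘(ℝ, E) 1 (fun z : ℝ × M ↦ flow W z.1 z.2) (t, x) :=
  (flowDomain_mem_nhds_and_contMDiffAt_flow hW h).2

lemma mem_flowDomain_zero
    (hW : ContMDiff 𝓘(ℝ, E) 𝓘(ℝ, E).tangent ∞ (fun x ↦ (⟨x, W x⟩ : TangentBundle 𝓘(ℝ, E) M)))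
    (x : M) : (0, x) ∈ flowDomain W := by
  obtain ⟨δ, hδ, N, hN, hx, h1⟩ := exists_flow_contMDiffAt hW x
  exact (h1 0 ⟨by linarith, hδ⟩ x hx).1

lemma mdifferentiableAt_flow
    (hW : ContMDiff 𝓘(ℝ, E) 𝓘(ℝ, E).tangent ∞ (fun x ↦ (⟨x, W x⟩ : TangentBundle 𝓘(ℝ, E) M)))
    {t : ℝ} {x : M} (h : (t, x) ∈ flowDomain W) :
    MDifferentiableAt 𝓘(ℝ, E) 𝓘(ℝ, E) (flow W t) x := by
  have h2 : MDifferentiableAt 𝓘(ℝ, E) (𝓘(ℝ, ℝ).prod 𝓘(ℝ, E)) (fun y : M ↦ (t, y)) x :=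
    mdifferentiableAt_const.prodMk mdifferentiableAt_id
  exact MDifferentiableAt.comp (g := fun z : ℝ × M ↦ flow W z.1 z.2) x
    ((contMDiffAt_flow hW h).mdifferentiableAt (by norm_num)) h2

lemma hasMFDerivAt_flow_time
    (hW : ContMDiff 𝓘(ℝ, E) 𝓘(ℝ, E).tangent ∞ (fun x ↦ (⟨x, W x⟩ : TangentBundle 𝓘(ℝ, E) M)))
    {t : ℝ} {x : M} (h : (t, x) ∈ flowDomain W) :
    HasMFDerivAt 𝓘(ℝ, ℝ) 𝓘(ℝ, E) (flow W · x) t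
      ((1 : ℝ →L[ℝ] ℝ).smulRight (W (flow W t x))) := by
  obtain ⟨a, b, h0, ht, hγ⟩ := exists_isMIntegralCurveOn_flow hW h
  exact (hγ.isMIntegralCurveAt (isOpen_Ioo.mem_nhds ht)).hasMFDerivAt

/-- The velocity of the image of a moving point under the flow: the flow contributes `W`, the motion
of the point is transported by the derivative of the flow. -/
theorem velocity_flow
    (hW : ContMDiff 𝓘(ℝ, E) 𝓘(ℝ, E).tangent ∞ (fun x ↦ (⟨x, W x⟩ : TangentBundle 𝓘(ℝ, E) M)))
    {p : ℝ → M} {t : ℝ} (h : (t, p t) ∈ flowDomain W)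
    (hp : MDifferentiableAt 𝓘(ℝ, ℝ) 𝓘(ℝ, E) p t) :
    MDifferentiableAt 𝓘(ℝ, ℝ) 𝓘(ℝ, E) (fun s ↦ flow W s (p s)) t ∧
    velocity (fun s ↦ flow W s (p s)) t =
      W (flow W t (p t)) + mfderiv 𝓘(ℝ, E) 𝓘(ℝ, E) (flow W t) (p t) (velocity p t) := by
  have h1 : MDifferentiableAt (𝓘(ℝ, ℝ).prod 𝓘(ℝ, E)) 𝓘(ℝ, E)
      (fun z : ℝ × M ↦ flow W z.1 z.2) (t, p t) :=
    (contMDiffAt_flow hW h).mdifferentiableAt (by norm_num)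
  have h2 : HasMFDerivAt 𝓘(ℝ, ℝ) (𝓘(ℝ, ℝ).prod 𝓘(ℝ, E)) (fun s ↦ (s, p s)) t _ :=
    (hasMFDerivAt_id t).prodMk hp.hasMFDerivAt
  have h3 := HasMFDerivAt.comp (g := fun z : ℝ × M ↦ flow W z.1 z.2) t h1.hasMFDerivAt h2
  refine ⟨h3.mdifferentiableAt, ?_⟩
  have h4 := h3.mfderiv
  let v : ℝ × E := (1, velocity (E := E) p t)
  have h5 := mfderiv_prod_eq_add_apply (f := fun z : ℝ × M ↦ flow W z.1 z.2) (p := (t, p t)) h1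
    (v := v)
  have h6 := (hasMFDerivAt_flow_time hW h).mfderiv
  refine (DFunLike.congr_fun h4 (1 : ℝ)).trans (h5.trans ?_)
  refine congrArg₂ (· + ·) ?_ rfl
  refine (DFunLike.congr_fun h6 (1 : ℝ)).trans ?_
  exact one_smul ℝ (W (flow W t (p t)))

end Zermelo

end

/-! ### The flow of an infinitesimal homothety -/

section

open Set Filter VectorField
open scoped Topology

namespace Zermelo

/-- The product rule for a bilinear form that is differentiable in the weak sense; in finite dimension
it suffices to differentiate the entries of its matrix. -/
lemma hasDerivAt_bilin_apply {E : Type*} [NormedAddCommGroup E] [NormedSpace ℝ E]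
    [FiniteDimensional ℝ E] {B : ℝ → E →ₗ[ℝ] E →ₗ[ℝ] ℝ} {B' : E →ₗ[ℝ] E →ₗ[ℝ] ℝ} {t : ℝ}
    (hB : ∀ u w, HasDerivAt (fun s ↦ B s u w) (B' u w) t) {y : ℝ → E} {y' : E}
    (hy : HasDerivAt y y' t) :
    HasDerivAt (fun s ↦ B s (y s) (y s)) (B' (y t) (y t) + (B t y' (y t) + B t (y t) y')) t := by
  set b := Module.finBasis ℝ E
  have hsum : ∀ (C : E →ₗ[ℝ] E →ₗ[ℝ] ℝ) (u w : E),
      C u w = ∑ i, ∑ j, b.repr u i * b.repr w j * C (b i) (b j) := by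
    intro C u w
    conv_lhs => rw [← b.sum_repr u, ← b.sum_repr w]
    simp only [map_sum, map_smul, LinearMap.sum_apply, LinearMap.smul_apply, smul_eq_mul,
      Finset.mul_sum]
    rw [Finset.sum_comm]
    refine Finset.sum_congr rfl fun i _ ↦ Finset.sum_congr rfl fun j _ ↦ ?_
    ring
  have hc : ∀ i, HasDerivAt (fun s ↦ b.repr (y s) i) (b.repr y' i) t := fun i ↦
    ((b.coord i).toContinuousLinearMap.hasFDerivAt).comp_hasDerivAt t hy
  have h1 : HasDerivAt (fun s ↦ ∑ i, ∑ j, b.repr (y s) i * b.repr (y s) j * B s (b i) (b j))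
      (∑ i, ∑ j, ((b.repr y' i * b.repr (y t) j + b.repr (y t) i * b.repr y' j) * B t (b i) (b j) +
        b.repr (y t) i * b.repr (y t) j * B' (b i) (b j))) t :=
    HasDerivAt.fun_sum fun i _ ↦ HasDerivAt.fun_sum fun j _ ↦
      ((hc i).mul (hc j)).mul (hB (b i) (b j))
  have h2 : (fun s ↦ B s (y s) (y s)) =
      fun s ↦ ∑ i, ∑ j, b.repr (y s) i * b.repr (y s) j * B s (b i) (b j) :=
    funext fun s ↦ hsum _ _ _
  rw [h2]
  refine h1.congr_deriv ?_
  rw [hsum B', hsum (B t) y', hsum (B t) (y t) y']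
  simp only [← Finset.sum_add_distrib]
  refine Finset.sum_congr rfl fun i _ ↦ Finset.sum_congr rfl fun j _ ↦ ?_
  ring

variable {E : Type*} [NormedAddCommGroup E] [NormedSpace ℝ E] [FiniteDimensional ℝ E]
  {M : Type*} [TopologicalSpace M] [T2Space M] [ChartedSpace E M] [IsManifold 𝓘(ℝ, E) ∞ M]
  {W : (x : M) → TangentSpace 𝓘(ℝ, E) x}

/-- The vector field that is constantly `u` in the preferred chart at `x₀`. -/
noncomputable def constField (x₀ : M) (u : E) : (x : M) → TangentSpace 𝓘(ℝ, E) x :=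
  mpullback 𝓘(ℝ, E) 𝓘(ℝ, E) (extChartAt 𝓘(ℝ, E) x₀) fun _ ↦ u

lemma constField_eq {x₀ x : M} (hx : x ∈ (extChartAt 𝓘(ℝ, E) x₀).source) (u : E) :
    constField x₀ u x = mfderivWithin 𝓘(ℝ, E) 𝓘(ℝ, E) (extChartAt 𝓘(ℝ, E) x₀).symm
      (range 𝓘(ℝ, E)) (extChartAt 𝓘(ℝ, E) x₀ x) u := by
  have h := isInvertible_mfderiv_extChartAt hx
  have h1 := mfderiv_extChartAt_comp_mfderivWithin_extChartAt_symm' hx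
  exact h.inverse_apply_eq.2 (DFunLike.congr_fun h1 u).symm

lemma constField_self (x₀ : M) (u : E) : constField x₀ u x₀ = u := by
  rw [constField_eq (mem_extChartAt_source x₀), mfderivWithin_range_extChartAt_symm]
  rfl

lemma constField_add (x₀ : M) (u w : E) (x : M) :
    constField x₀ (u + w) x = constField x₀ u x + constField x₀ w x :=
  map_add (mfderiv 𝓘(ℝ, E) 𝓘(ℝ, E) (extChartAt 𝓘(ℝ, E) x₀) x).inverse u w

lemma constField_smul (x₀ : M) (c : ℝ) (u : E) (x : M) :
    constField x₀ (c • u) x = c • constField x₀ u x :=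
  map_smul (mfderiv 𝓘(ℝ, E) 𝓘(ℝ, E) (extChartAt 𝓘(ℝ, E) x₀) x).inverse c u

lemma contMDiffAt_constField (x₀ : M) (u : E) :
    ContMDiffAt 𝓘(ℝ, E) 𝓘(ℝ, E).tangent ∞
      (fun x ↦ (⟨x, constField x₀ u x⟩ : TangentBundle 𝓘(ℝ, E) M)) x₀ := by
  refine ContMDiffAt.mpullback_vectorField_preimage (n := ∞) ?_ contMDiffAt_extChartAt
    (isInvertible_mfderiv_extChartAt (mem_extChartAt_source x₀)) (by simp)
  exact contMDiffAt_vectorSpace_iff_contDiffAt (V := fun _ ↦ u) |>.2 contDiffAt_const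

lemma mlieBracket_constField (x₀ : M) (u : E) :
    mlieBracket 𝓘(ℝ, E) W (constField x₀ u) x₀ =
      -constField x₀ (fderiv ℝ (chartField W x₀) (extChartAt 𝓘(ℝ, E) x₀ x₀) u) x₀ := by
  set V : E → E := mpullbackWithin 𝓘(ℝ, E) 𝓘(ℝ, E) (extChartAt 𝓘(ℝ, E) x₀).symm (constField x₀ u)
      (range 𝓘(ℝ, E)) with hV
  have h1 : V =ᶠ[𝓝 (extChartAt 𝓘(ℝ, E) x₀ x₀)] fun _ ↦ u := by
    filter_upwards [extChartAt_target_mem_nhds (I := 𝓘(ℝ, E)) x₀] with y hy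
    have h := isInvertible_mfderivWithin_extChartAt_symm hy
    refine h.inverse_apply_eq.2 ?_
    rw [constField_eq ((extChartAt 𝓘(ℝ, E) x₀).map_target hy), (extChartAt 𝓘(ℝ, E) x₀).right_inv hy]
  have h2 : lieBracketWithin ℝ (chartField W x₀) V
      ((extChartAt 𝓘(ℝ, E) x₀).symm ⁻¹' univ ∩ range 𝓘(ℝ, E)) (extChartAt 𝓘(ℝ, E) x₀ x₀) =
      -fderiv ℝ (chartField W x₀) (extChartAt 𝓘(ℝ, E) x₀ x₀) u := by
    simp only [preimage_univ, univ_inter, modelWithCornersSelf_coe, range_id, lieBracketWithin_univ,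
      lieBracket_eq]
    rw [h1.fderiv_eq, h1.self_of_nhds]
    simp
  have hinv := isInvertible_mfderiv_extChartAt (I := 𝓘(ℝ, E)) (mem_extChartAt_source (I := 𝓘(ℝ, E)) x₀)
  rw [← mlieBracketWithin_univ, mlieBracketWithin_apply]
  refine (congrArg _ h2).trans ?_
  exact map_neg (mfderiv 𝓘(ℝ, E) 𝓘(ℝ, E) (extChartAt 𝓘(ℝ, E) x₀) x₀).inverse _

variable [RiemannianBundle (fun x : M ↦ TangentSpace 𝓘(ℝ, E) x)]
  [IsContMDiffRiemannianBundle 𝓘(ℝ, E) ∞ E (fun x : M ↦ TangentSpace 𝓘(ℝ, E) x)]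

/-- The metric on vectors written in the preferred chart at `x₀`. -/
noncomputable def chartMetric (x₀ x : M) : E →ₗ[ℝ] E →ₗ[ℝ] ℝ :=
  LinearMap.mk₂ ℝ (fun u w ↦ inner ℝ (constField x₀ u x) (constField x₀ w x))
    (fun u u' w ↦ by rw [constField_add, inner_add_left])
    (fun c u w ↦ by rw [constField_smul, inner_smul_left]; rfl)
    (fun u w w' ↦ by rw [constField_add, inner_add_right])
    (fun c u w ↦ by rw [constField_smul, inner_smul_right]; rfl)

lemma chartMetric_apply (x₀ x : M) (u w : E) :
    chartMetric x₀ x u w = inner ℝ (constField x₀ u x) (constField x₀ w x) := rfl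

lemma contMDiffAt_inner_bundle {b : M → M} {v w : (x : M) → TangentSpace 𝓘(ℝ, E) (b x)} {x : M}
    (hv : ContMDiffAt 𝓘(ℝ, E) 𝓘(ℝ, E).tangent ∞ (fun x ↦ (⟨b x, v x⟩ : TangentBundle 𝓘(ℝ, E) M)) x)
    (hw : ContMDiffAt 𝓘(ℝ, E) 𝓘(ℝ, E).tangent ∞ (fun x ↦ (⟨b x, w x⟩ : TangentBundle 𝓘(ℝ, E) M)) x) :
    ContMDiffAt 𝓘(ℝ, E) 𝓘(ℝ, ℝ) ∞ (fun x ↦ (inner ℝ (v x) (w x) : ℝ)) x := by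
  -- The instances are given explicitly, as unification finds the norm of `E` on the fibres.
  exact @ContMDiffAt.inner_bundle E _ _ E _ 𝓘(ℝ, E) ∞ M _ _ E _ _ (fun x ↦ TangentSpace 𝓘(ℝ, E) x) _
    (fun _ ↦ inferInstance) (fun _ ↦ inferInstance) _ _ E _ _ E _ 𝓘(ℝ, E) M _ _ _ b v w x hv hw

lemma mdifferentiableAt_chartMetric (x₀ : M) (u w : E) :
    MDifferentiableAt 𝓘(ℝ, E) 𝓘(ℝ, ℝ) (fun x ↦ chartMetric x₀ x u w) x₀ :=
  (contMDiffAt_inner_bundle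
    (contMDiffAt_constField x₀ u) (contMDiffAt_constField x₀ w)).mdifferentiableAt (by simp)

/-- The equation `L_W h = σ h` for constant vector fields, whose brackets with `W` are given by the
derivative of `W`. -/
lemma derivAlong_chartMetric {σ : ℝ} (hσ : IsInfinitesimalHomothety W σ) (x₀ : M) (u w : E) :
    derivAlong W (fun x ↦ chartMetric x₀ x u w) x₀ = σ * chartMetric x₀ x₀ u w
      - chartMetric x₀ x₀ (fderiv ℝ (chartField W x₀) (extChartAt 𝓘(ℝ, E) x₀ x₀) u) w
      - chartMetric x₀ x₀ u (fderiv ℝ (chartField W x₀) (extChartAt 𝓘(ℝ, E) x₀ x₀) w) := by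
  have h := hσ x₀ _ _ (contMDiffAt_constField x₀ u) (contMDiffAt_constField x₀ w)
  rw [lieDerivMetric, mlieBracket_constField, mlieBracket_constField, inner_neg_left,
    inner_neg_right] at h
  simp only [← chartMetric_apply] at h
  linarith

/-- The infinitesimal version of `norm_mfderiv_flow`. In a chart `dψ_s v` is a solution `y` of
`y' = dW(y)`, so the derivative of the metric along `W` cancels the terms from `y'` up to `σ |v|²`. -/
lemma hasDerivAt_norm_sq_mfderiv_flow_zero
    (hW : ContMDiff 𝓘(ℝ, E) 𝓘(ℝ, E).tangent ∞ (fun x ↦ (⟨x, W x⟩ : TangentBundle 𝓘(ℝ, E) M)))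
    {σ : ℝ} (hσ : IsInfinitesimalHomothety W σ) (x : M) (v : TangentSpace 𝓘(ℝ, E) x) :
    HasDerivAt (fun s ↦ ‖mfderiv 𝓘(ℝ, E) 𝓘(ℝ, E) (flow W s) x v‖ ^ 2) (σ * ‖v‖ ^ 2) 0 := by
  obtain ⟨δ, hδ, N, hN, hxN, Φ, hΦ, hsm, hlin⟩ := exists_localFlow hW x
  obtain ⟨y, hy0, hy, hyt⟩ := hlin v
  have hB : ∀ u w : E, HasDerivAt (fun s ↦ chartMetric x (flow W s x) u w)
      (derivAlong (E := E) W (fun z ↦ chartMetric x z u w) x) 0 := by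
    intro u w
    have h1 := hasMFDerivAt_flow_time hW (mem_flowDomain_zero hW x)
    have h2 : MDifferentiableAt 𝓘(ℝ, E) 𝓘(ℝ, ℝ) (fun z ↦ chartMetric x z u w) (flow W 0 x) := by
      rw [flow_zero]; exact mdifferentiableAt_chartMetric x u w
    have h3 := HasMFDerivAt.comp (0 : ℝ) h2.hasMFDerivAt h1
    let L : ℝ →L[ℝ] ℝ := (mfderiv 𝓘(ℝ, E) 𝓘(ℝ, ℝ) (fun z ↦ chartMetric x z u w) (flow W 0 x)).comp
      ((1 : ℝ →L[ℝ] ℝ).smulRight (W (flow W 0 x)))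
    have h4 : HasFDerivAt (fun s ↦ chartMetric x (flow W s x) u w) L 0 :=
      hasMFDerivAt_iff_hasFDerivAt.1 h3
    refine h4.hasDerivAt.congr_deriv ?_
    have h5 : L 1 = derivAlong (E := E) W (fun z ↦ chartMetric x z u w) (flow W 0 x) :=
      congrArg _ (one_smul ℝ (W (flow W 0 x)))
    rw [h5, flow_zero]
  set A : E →ₗ[ℝ] E := (fderiv ℝ (chartField W x) (extChartAt 𝓘(ℝ, E) x x)).toLinearMap
  set B : E →ₗ[ℝ] E →ₗ[ℝ] ℝ := chartMetric x x with hBdef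
  have hB2 : ∀ u w : E, HasDerivAt (fun s ↦ chartMetric x (flow W s x) u w)
      ((σ • B - B.compl₁₂ A LinearMap.id - B.compl₁₂ LinearMap.id A) u w) 0 := by
    intro u w
    refine (hB u w).congr_deriv ?_
    rw [derivAlong_chartMetric hσ]
    rfl
  have key := hasDerivAt_bilin_apply hB2 hy
  have h0 : flow W 0 x = x := flow_zero x
  have h1 : ∀ v : E, B v v = ‖(show TangentSpace 𝓘(ℝ, E) x from v)‖ ^ 2 := by
    intro v
    rw [hBdef, chartMetric_apply, constField_self]
    exact real_inner_self_eq_norm_sq (F := TangentSpace 𝓘(ℝ, E) x) v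
  have hval : (σ • B - B.compl₁₂ A LinearMap.id - B.compl₁₂ LinearMap.id A) (y 0) (y 0) +
      (chartMetric x (flow W 0 x) (A (y 0)) (y 0) + chartMetric x (flow W 0 x) (y 0) (A (y 0))) =
      σ * B (y 0) (y 0) := by
    rw [h0, ← hBdef]
    simp only [LinearMap.sub_apply, LinearMap.smul_apply, LinearMap.compl₁₂_apply,
      LinearMap.id_coe, id_eq, smul_eq_mul]
    ring
  rw [← hy0] at key
  have key2 := key.congr_deriv hval
  rw [h1, hy0] at key2
  refine key2.congr_of_eventuallyEq ?_
  filter_upwards [Ioo_mem_nhds (neg_lt_zero.2 hδ) hδ] with s hs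
  obtain ⟨hsrc, hs2⟩ := hyt s hs
  obtain ⟨-, hfl⟩ := flow_eq_localFlow hW hΦ hs hxN
  have hev : flow W s =ᶠ[𝓝 x] Φ s := by
    filter_upwards [hN.mem_nhds hxN] with z hz
    exact (flow_eq_localFlow hW hΦ hs hz).2
  rw [chartMetric_apply, real_inner_self_eq_norm_sq, hev.mfderiv_eq, hfl, constField_eq hsrc, hs2]

lemma norm_mfderiv_flow_add
    (hW : ContMDiff 𝓘(ℝ, E) 𝓘(ℝ, E).tangent ∞ (fun x ↦ (⟨x, W x⟩ : TangentBundle 𝓘(ℝ, E) M)))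
    {s t : ℝ} {x : M} (hs : (s, x) ∈ flowDomain W) (ht : (t, flow W s x) ∈ flowDomain W)
    (v : TangentSpace 𝓘(ℝ, E) x) :
    ‖mfderiv 𝓘(ℝ, E) 𝓘(ℝ, E) (flow W (s + t)) x v‖ =
      ‖mfderiv 𝓘(ℝ, E) 𝓘(ℝ, E) (flow W t) (flow W s x)
        (mfderiv 𝓘(ℝ, E) 𝓘(ℝ, E) (flow W s) x v)‖ := by
  have hc := (mdifferentiableAt_flow hW hs).continuousAt
  have h1 : ∀ᶠ y in 𝓝 x, (s, y) ∈ flowDomain W :=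
    (Continuous.prodMk_right s).continuousAt.eventually ((isOpen_flowDomain hW).mem_nhds hs)
  have h2 : ∀ᶠ y in 𝓝 x, (t, flow W s y) ∈ flowDomain W :=
    hc.eventually ((Continuous.prodMk_right t).continuousAt.eventually
      ((isOpen_flowDomain hW).mem_nhds ht))
  have hev : flow W (s + t) =ᶠ[𝓝 x] flow W t ∘ flow W s := by
    filter_upwards [h1, h2] with y hy1 hy2 using (flow_add hW hy1 hy2).2
  rw [hev.mfderiv_eq, (flow_add hW hs ht).2,
    mfderiv_comp x (mdifferentiableAt_flow hW ht) (mdifferentiableAt_flow hW hs)]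
  rfl

/-- The flow of an infinitesimal homothety consists of homotheties. -/
theorem norm_mfderiv_flow
    (hW : ContMDiff 𝓘(ℝ, E) 𝓘(ℝ, E).tangent ∞ (fun x ↦ (⟨x, W x⟩ : TangentBundle 𝓘(ℝ, E) M)))
    {σ : ℝ} (hσ : IsInfinitesimalHomothety W σ) {t : ℝ} {x : M} (h : (t, x) ∈ flowDomain W)
    (v : TangentSpace 𝓘(ℝ, E) x) :
    ‖mfderiv 𝓘(ℝ, E) 𝓘(ℝ, E) (flow W t) x v‖ = Real.exp (σ * t / 2) * ‖v‖ := by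
  obtain ⟨γ, hγ0, a, b, h0, ht, hγ⟩ := h
  have hD : ∀ s ∈ Ioo a b, (s, x) ∈ flowDomain W := fun s hs ↦ ⟨γ, hγ0, a, b, h0, hs, hγ⟩
  set g : ℝ → ℝ := fun s ↦ ‖mfderiv 𝓘(ℝ, E) 𝓘(ℝ, E) (flow W s) x v‖ ^ 2 with hg
  have hg' : ∀ s ∈ Ioo a b, HasDerivAt g (σ * g s) s := by
    intro s hs
    have h1 := hasDerivAt_norm_sq_mfderiv_flow_zero hW hσ (flow W s x)
      (mfderiv 𝓘(ℝ, E) 𝓘(ℝ, E) (flow W s) x v)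
    have h2 : (fun τ ↦ g (s + τ)) =ᶠ[𝓝 0] fun τ ↦ ‖mfderiv 𝓘(ℝ, E) 𝓘(ℝ, E) (flow W τ) (flow W s x)
        (mfderiv 𝓘(ℝ, E) 𝓘(ℝ, E) (flow W s) x v)‖ ^ 2 := by
      filter_upwards [(Continuous.prodMk_left (flow W s x)).continuousAt.eventually
        ((isOpen_flowDomain hW).mem_nhds (mem_flowDomain_zero hW (flow W s x)))] with τ hτ
      rw [hg]
      exact congrArg (· ^ 2) (norm_mfderiv_flow_add hW (hD s hs) hτ v)
    have h3 := h1.congr_of_eventuallyEq h2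
    have h4 : HasDerivAt (fun τ ↦ g (s + (τ - s))) (σ * g s) s := by
      rw [← sub_self s] at h3
      exact h3.comp_sub_const s s
    simpa using h4
  -- as `g' = σ g`, the product with `e ^ (-σ s)` is constant
  set k : ℝ → ℝ := fun s ↦ Real.exp (-σ * s) * g s with hk
  have hk' : ∀ s ∈ Ioo a b, HasDerivAt k 0 s := by
    intro s hs
    have h1 : HasDerivAt (fun s ↦ Real.exp (-σ * s)) (Real.exp (-σ * s) * (-σ)) s := by
      simpa using ((hasDerivAt_id s).const_mul (-σ)).exp
    refine (h1.mul (hg' s hs)).congr_deriv ?_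
    ring
  have hconst : k t = k 0 :=
    isOpen_Ioo.is_const_of_deriv_eq_zero isPreconnected_Ioo
      (fun s hs ↦ (hk' s hs).differentiableAt.differentiableWithinAt)
      (fun s hs ↦ (hk' s hs).deriv) ht h0
  have hg0 : g 0 = ‖v‖ ^ 2 := by
    have h1 : flow W 0 = (id : M → M) := funext fun x ↦ flow_zero x
    simp only [hg]
    rw [h1, mfderiv_id]
    rfl
  have hgt : g t = (Real.exp (σ * t / 2) * ‖v‖) ^ 2 := by
    have h1 : Real.exp (-σ * t) * g t = ‖v‖ ^ 2 := by
      have : k 0 = g 0 := by simp [hk]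
      rw [← hg0, ← this, ← hconst]
    have h2 : Real.exp (σ * t / 2) ^ 2 * Real.exp (-σ * t) = 1 := by
      rw [← Real.exp_nat_mul, ← Real.exp_add, Real.exp_eq_one_iff]
      push_cast; ring
    calc g t = (Real.exp (σ * t / 2) ^ 2 * Real.exp (-σ * t)) * g t := by rw [h2, one_mul]
      _ = Real.exp (σ * t / 2) ^ 2 * (Real.exp (-σ * t) * g t) := by ring
      _ = _ := by rw [h1]; ring
  exact (pow_left_inj₀ (norm_nonneg _) (by positivity) two_ne_zero).1 hgt

/-- In the frame moving with the wind the control is the velocity, up to the scale factor of the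
homothety. -/
theorem norm_velocity_flow_sub
    (hW : ContMDiff 𝓘(ℝ, E) 𝓘(ℝ, E).tangent ∞ (fun x ↦ (⟨x, W x⟩ : TangentBundle 𝓘(ℝ, E) M)))
    {σ : ℝ} (hσ : IsInfinitesimalHomothety W σ) {p : ℝ → M} {t : ℝ}
    (h : (t, p t) ∈ flowDomain W) (hp : MDifferentiableAt 𝓘(ℝ, ℝ) 𝓘(ℝ, E) p t) :
    ‖velocity (E := E) (fun s ↦ flow W s (p s)) t - W (flow W t (p t))‖ =
      Real.exp (σ * t / 2) * ‖velocity (E := E) p t‖ := by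
  rw [← norm_mfderiv_flow hW hσ h (velocity (E := E) p t), (velocity_flow hW h hp).2]
  exact congrArg norm (add_sub_cancel_left (W (flow W t (p t))) _)

end Zermelo

end

/-! ### Piecewise `C¹` curves -/

section

open Set Filter MeasureTheory
open scoped Topology

namespace Zermelo

variable {E : Type*} [NormedAddCommGroup E] [NormedSpace ℝ E]
  {M : Type*} [TopologicalSpace M] [ChartedSpace E M] {γ η : ℝ → M} {a b c : ℝ}

lemma ae_of_eventually_cofinite {P : ℝ → Prop} (h : ∀ᶠ t in cofinite, P t) : ∀ᵐ t, P t :=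
  (h : {t | ¬ P t}.Finite).measure_zero _

lemma eventually_cofinite_ne_real (a : ℝ) : ∀ᶠ t in cofinite, t ≠ a :=
  (finite_singleton a).compl_mem_cofinite

lemma velocity_congr {t : ℝ} (h : γ =ᶠ[𝓝 t] η) :
    (⟨γ t, velocity γ t⟩ : TangentBundle 𝓘(ℝ, E) M) = ⟨η t, velocity η t⟩ := by
  unfold velocity
  rw [h.mfderiv_eq, h.self_of_nhds]

lemma velocity_comp {θ : ℝ → ℝ} {θ' t : ℝ} (hθ : HasDerivAt θ θ' t)
    (hγ : MDifferentiableAt 𝓘(ℝ, ℝ) 𝓘(ℝ, E) γ (θ t)) :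
    MDifferentiableAt 𝓘(ℝ, ℝ) 𝓘(ℝ, E) (γ ∘ θ) t ∧
      velocity (E := E) (γ ∘ θ) t = θ' • velocity (E := E) γ (θ t) := by
  have h := HasMFDerivAt.comp t hγ.hasMFDerivAt hθ.hasFDerivAt.hasMFDerivAt
  refine ⟨h.mdifferentiableAt, ?_⟩
  unfold velocity
  rw [h.mfderiv]
  have : (ContinuousLinearMap.toSpanSingleton ℝ θ' : ℝ →L[ℝ] ℝ) 1 = θ' • (1 : ℝ) := by simp
  refine (congrArg (mfderiv 𝓘(ℝ, ℝ) 𝓘(ℝ, E) γ (θ t)) this).trans ?_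
  exact map_smul (mfderiv 𝓘(ℝ, ℝ) 𝓘(ℝ, E) γ (θ t)) θ' (1 : ℝ)

namespace IsPiecewiseC1

lemma le (h : IsPiecewiseC1 E γ a b) : a ≤ b := by
  induction h with
  | piece hab _ => exact hab
  | append _ _ h1 h2 => exact h1.trans h2

lemma congr (h : IsPiecewiseC1 E γ a b) (hγ : EqOn η γ (Icc a b)) : IsPiecewiseC1 E η a b := by
  induction h with
  | piece hab h => exact piece hab (h.congr hγ)
  | append h1 h2 ih1 ih2 =>
    exact append (ih1 (hγ.mono (Icc_subset_Icc_right h2.le)))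
      (ih2 (hγ.mono (Icc_subset_Icc_left h1.le)))

lemma restrict (h : IsPiecewiseC1 E γ a b) {a' b' : ℝ} (ha : a ≤ a') (hab : a' ≤ b')
    (hb : b' ≤ b) : IsPiecewiseC1 E γ a' b' := by
  induction h generalizing a' b' with
  | piece _ h => exact piece hab (h.mono (Icc_subset_Icc ha hb))
  | @append a m b _ _ ih1 ih2 =>
    rcases le_total b' m with h | h
    · exact ih1 ha hab h
    rcases le_total m a' with h' | h'
    · exact ih2 h' hab hb
    · exact append (ih1 ha h' le_rfl) (ih2 le_rfl h hb)

lemma comp (h : IsPiecewiseC1 E γ a b) {θ : ℝ → ℝ} (hθ : ContDiff ℝ 1 θ) (hmono : StrictMono θ)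
    {A B : ℝ} (hA : θ A = a) (hB : θ B = b) : IsPiecewiseC1 E (γ ∘ θ) A B := by
  induction h generalizing A B with
  | piece hab h =>
    subst hA hB
    refine piece (hmono.le_iff_le.1 hab) (h.comp hθ.contMDiff.contMDiffOn ?_)
    exact fun t ht ↦ ⟨hmono.monotone ht.1, hmono.monotone ht.2⟩
  | @append a m b h1 h2 ih1 ih2 =>
    subst hA hB
    have hAB : A ≤ B := hmono.le_iff_le.1 (h1.le.trans h2.le)
    obtain ⟨C, -, hC⟩ := intermediate_value_Icc hAB hθ.continuous.continuousOn ⟨h1.le, h2.le⟩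
    exact append (ih1 rfl hC) (ih2 hC rfl)

lemma continuousOn (h : IsPiecewiseC1 E γ a b) : ContinuousOn γ (Icc a b) := by
  induction h with
  | piece _ h => exact h.continuousOn
  | append h1 h2 ih1 ih2 =>
    rw [← Icc_union_Icc_eq_Icc h1.le h2.le]
    exact ih1.union_of_isClosed ih2 isClosed_Icc isClosed_Icc

lemma eventually_mdifferentiableAt (h : IsPiecewiseC1 E γ a b) :
    ∀ᶠ t in cofinite, t ∈ Ioo a b → MDifferentiableAt 𝓘(ℝ, ℝ) 𝓘(ℝ, E) γ t := by
  induction h with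
  | piece _ h =>
    exact Eventually.of_forall fun t ht ↦
      ((h.contMDiffAt (Icc_mem_nhds ht.1 ht.2)).mdifferentiableAt (by simp))
  | @append a m b _ _ ih1 ih2 =>
    filter_upwards [ih1, ih2, eventually_cofinite_ne_real m] with t h1 h2 h3 ht
    rcases lt_or_gt_of_ne h3 with h | h
    · exact h1 ⟨ht.1, h⟩
    · exact h2 ⟨h, ht.2⟩

variable [IsManifold 𝓘(ℝ, E) ∞ M]

/-- On a piece the velocity extends continuously to the end points. -/
lemma _root_.Zermelo.exists_continuousOn_velocity (hab : a < b)
    (h : ContMDiffOn 𝓘(ℝ, ℝ) 𝓘(ℝ, E) 1 γ (Icc a b)) :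
    ∃ w : ℝ → TangentBundle 𝓘(ℝ, E) M, ContinuousOn w (Icc a b) ∧
      ∀ t ∈ Icc a b, MDifferentiableAt 𝓘(ℝ, ℝ) 𝓘(ℝ, E) γ t → w t = ⟨γ t, velocity γ t⟩ := by
  have hu : UniqueMDiffOn 𝓘(ℝ, ℝ) (Icc a b) := (uniqueDiffOn_Icc hab).uniqueMDiffOn
  refine ⟨fun t ↦ tangentMapWithin 𝓘(ℝ, ℝ) 𝓘(ℝ, E) γ (Icc a b)
    (⟨t, (1 : ℝ)⟩ : TangentBundle 𝓘(ℝ, ℝ) ℝ), ?_, ?_⟩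
  · have : IsManifold 𝓘(ℝ, E) 1 M := .of_le (n := ∞) (by simp)
    refine (h.continuousOn_tangentMapWithin le_rfl hu).comp ?_ fun t ht ↦ ht
    exact ((tangentBundleModelSpaceHomeomorph 𝓘(ℝ, ℝ)).symm.continuous.comp
      (Continuous.prodMk_left (1 : ℝ))).continuousOn
  · intro t ht hd
    simp only [tangentMapWithin, velocity]
    rw [mfderivWithin_eq_mfderiv (hu t ht) hd]

/-- A closed condition which holds for almost all velocities holds wherever there is a velocity. -/
lemma mem_of_ae (h : IsPiecewiseC1 E γ a b) {C : Set (TangentBundle 𝓘(ℝ, E) M)} (hC : IsClosed C)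
    (hae : ∀ᵐ t, t ∈ Ioo a b → (⟨γ t, velocity γ t⟩ : TangentBundle 𝓘(ℝ, E) M) ∈ C) {t : ℝ}
    (hab : a < b) (ht : t ∈ Icc a b) (hd : MDifferentiableAt 𝓘(ℝ, ℝ) 𝓘(ℝ, E) γ t) :
    (⟨γ t, velocity γ t⟩ : TangentBundle 𝓘(ℝ, E) M) ∈ C := by
  induction h with
  | @piece a b _ h =>
    obtain ⟨w, hw, hwv⟩ := exists_continuousOn_velocity hab h
    have hae' : ∀ᵐ t, t ∈ Ioo a b → w t ∈ C := by
      filter_upwards [hae] with s hs hsI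
      rw [hwv s (Ioo_subset_Icc_self hsI)
        ((h.contMDiffAt (Icc_mem_nhds hsI.1 hsI.2)).mdifferentiableAt (by simp))]
      exact hs hsI
    rw [← hwv t ht hd]
    have hdense : Icc a b ⊆ closure (Ioo a b ∩ {t | t ∈ Ioo a b → w t ∈ C}) := by
      rw [← closure_Ioo hab.ne]
      have : Dense {t | t ∈ Ioo a b → w t ∈ C} := Measure.dense_of_ae hae'
      exact closure_minimal (this.open_subset_closure_inter isOpen_Ioo) isClosed_closure
    have h1 := (hw t ht).mono_left (nhdsWithin_mono t
      (inter_subset_left.trans Ioo_subset_Icc_self : Ioo a b ∩ {t | t ∈ Ioo a b → w t ∈ C} ⊆ _))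
    have : (𝓝[Ioo a b ∩ {t | t ∈ Ioo a b → w t ∈ C}] t).NeBot :=
      mem_closure_iff_nhdsWithin_neBot.1 (hdense ht)
    exact hC.mem_of_tendsto h1 (eventually_mem_nhdsWithin.mono fun s hs ↦ hs.2 hs.1)
  | @append a m b h1 h2 ih1 ih2 =>
    have hae1 : ∀ᵐ t, t ∈ Ioo a m → (⟨γ t, velocity γ t⟩ : TangentBundle 𝓘(ℝ, E) M) ∈ C :=
      hae.mono fun s hs hsI ↦ hs ⟨hsI.1, hsI.2.trans_le h2.le⟩
    have hae2 : ∀ᵐ t, t ∈ Ioo m b → (⟨γ t, velocity γ t⟩ : TangentBundle 𝓘(ℝ, E) M) ∈ C :=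
      hae.mono fun s hs hsI ↦ hs ⟨h1.le.trans_lt hsI.1, hsI.2⟩
    rcases h1.le.eq_or_lt with rfl | ham
    · exact ih2 hae2 hab ht
    rcases h2.le.eq_or_lt with rfl | hmb
    · exact ih1 hae1 hab ht
    rcases le_total t m with h | h
    · exact ih1 hae1 ham ⟨ht.1, h⟩
    · exact ih2 hae2 hmb ⟨h, ht.2⟩

lemma intervalIntegrable {F : (x : M) → TangentSpace 𝓘(ℝ, E) x → ℝ}
    (hF : Continuous fun z : TangentBundle 𝓘(ℝ, E) M ↦ F z.1 z.2) (h : IsPiecewiseC1 E γ a b) :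
    IntervalIntegrable (fun s ↦ F (γ s) (velocity γ s)) volume a b := by
  induction h with
  | @piece a b hab h =>
    rcases hab.eq_or_lt with rfl | hab'
    · exact IntervalIntegrable.refl
    obtain ⟨w, hw, hwv⟩ := exists_continuousOn_velocity hab' h
    have h1 : IntervalIntegrable (fun s ↦ F (w s).1 (w s).2) volume a b := by
      refine ContinuousOn.intervalIntegrable ?_
      rw [uIcc_of_le hab]
      exact hF.comp_continuousOn hw
    refine h1.congr_ae ?_
    rw [EventuallyEq, uIoc_of_le hab, ae_restrict_iff' measurableSet_Ioc]
    filter_upwards [ae_of_eventually_cofinite (eventually_cofinite_ne_real b)] with s hs hsI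
    have hsI' : s ∈ Ioo a b := ⟨hsI.1, lt_of_le_of_ne hsI.2 hs⟩
    rw [hwv s (Ioo_subset_Icc_self hsI')
      ((h.contMDiffAt (Icc_mem_nhds hsI'.1 hsI'.2)).mdifferentiableAt (by simp))]
  | append _ _ ih1 ih2 => exact ih1.trans ih2

end IsPiecewiseC1

/-- `γ` up to time `b`, then `η`. -/
noncomputable def glue (b : ℝ) (γ η : ℝ → M) (t : ℝ) : M := if t ≤ b then γ t else η t

lemma glue_eqOn_left : EqOn (glue b γ η) γ (Iic b) := fun t (ht : t ≤ b) ↦ by simp [glue, ht]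

lemma glue_eqOn_right (h : γ b = η b) : EqOn (glue b γ η) η (Ici b) := fun t (ht : b ≤ t) ↦ by
  rcases ht.eq_or_lt with rfl | ht
  · simp [glue, h]
  · simp [glue, ht.not_ge]

lemma IsPiecewiseC1.glue (hγ : IsPiecewiseC1 E γ a b) (hη : IsPiecewiseC1 E η b c)
    (h : γ b = η b) : IsPiecewiseC1 E (glue b γ η) a c :=
  append (hγ.congr (glue_eqOn_left.mono fun _ ht ↦ ht.2))
    (hη.congr ((glue_eqOn_right h).mono fun _ ht ↦ ht.1))

lemma velocity_glue_left {t : ℝ} (ht : t < b) :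
    (⟨glue b γ η t, velocity (glue b γ η) t⟩ : TangentBundle 𝓘(ℝ, E) M) = ⟨γ t, velocity γ t⟩ :=
  velocity_congr (glue_eqOn_left.eventuallyEq_of_mem (Iic_mem_nhds ht))

lemma velocity_glue_right {t : ℝ} (h : γ b = η b) (ht : b < t) :
    (⟨glue b γ η t, velocity (glue b γ η) t⟩ : TangentBundle 𝓘(ℝ, E) M) = ⟨η t, velocity η t⟩ :=
  velocity_congr ((glue_eqOn_right h).eventuallyEq_of_mem (Ici_mem_nhds ht))

lemma isPiecewiseC1_const (x : M) (hab : a ≤ b) : IsPiecewiseC1 E (fun _ ↦ x) a b :=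
  .piece hab contMDiffOn_const

lemma velocity_const (x : M) (t : ℝ) : velocity (E := E) (fun _ : ℝ ↦ x) t = 0 := by
  unfold velocity
  rw [mfderiv_const]
  rfl

end Zermelo

end

/-! ### The Randers norm -/

section

open Set Filter MeasureTheory
open scoped Topology

namespace Zermelo

section Algebra

variable {V : Type*} [NormedAddCommGroup V] [InnerProductSpace ℝ V]

lemma norm_sub_le_one_iff {v w : V} :
    ‖v - w‖ ≤ 1 ↔ ‖v‖ ^ 2 - 2 * inner ℝ v w + ‖w‖ ^ 2 ≤ 1 := by
  rw [← norm_sub_sq_real, sq_le_one_iff₀ (norm_nonneg _)]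

lemma norm_sub_eq_one_iff {v w : V} :
    ‖v - w‖ = 1 ↔ ‖v‖ ^ 2 - 2 * inner ℝ v w + ‖w‖ ^ 2 = 1 := by
  rw [← norm_sub_sq_real, pow_eq_one_iff_of_nonneg (norm_nonneg _) two_ne_zero]

/-- The Randers norm is the gauge of the unit ball centred at `w`. -/
lemma randers_formula_le_one_iff {v w : V} (hw : ‖w‖ < 1) :
    (-inner ℝ v w + √((inner ℝ v w) ^ 2 + ‖v‖ ^ 2 * (1 - ‖w‖ ^ 2))) / (1 - ‖w‖ ^ 2) ≤ 1 ↔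
      ‖v - w‖ ≤ 1 := by
  have hl : 0 < 1 - ‖w‖ ^ 2 := by nlinarith [norm_nonneg w]
  rw [div_le_one hl, norm_sub_le_one_iff, neg_add_le_iff_le_add, Real.sqrt_le_iff]
  set l := 1 - ‖w‖ ^ 2 with hldef
  have h2 : ‖w‖ ^ 2 = 1 - l := by rw [hldef]; ring
  rw [h2]
  -- `(⟪v, w⟫ + l) ^ 2 - (⟪v, w⟫ ^ 2 + ‖v‖ ^ 2 * l) = l * (l + 2 * ⟪v, w⟫ - ‖v‖ ^ 2)`
  constructor
  · rintro ⟨-, h⟩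
    by_contra! h3
    nlinarith
  · intro h
    refine ⟨by nlinarith [sq_nonneg ‖v‖], by nlinarith⟩

/-- The unit sphere of the Randers norm is the unit sphere centred at `w`. -/
lemma randers_formula_eq_one_iff {v w : V} (hw : ‖w‖ < 1) :
    (-inner ℝ v w + √((inner ℝ v w) ^ 2 + ‖v‖ ^ 2 * (1 - ‖w‖ ^ 2))) / (1 - ‖w‖ ^ 2) = 1 ↔
      ‖v - w‖ = 1 := by
  have hl : 0 < 1 - ‖w‖ ^ 2 := by nlinarith [norm_nonneg w]
  rw [div_eq_one_iff_eq hl.ne', norm_sub_eq_one_iff]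
  set l := 1 - ‖w‖ ^ 2 with hldef
  have h2 : ‖w‖ ^ 2 = 1 - l := by rw [hldef]; ring
  rw [h2, neg_add_eq_iff_eq_add]
  constructor
  · intro h
    have h3 := Real.sq_sqrt (show 0 ≤ (inner ℝ v w) ^ 2 + ‖v‖ ^ 2 * l by positivity)
    rw [h] at h3
    refine mul_left_cancel₀ hl.ne' ?_
    linarith
  · intro h
    have h4 : 0 ≤ inner ℝ v w + l := by nlinarith [sq_nonneg ‖v‖]
    rw [show (inner ℝ v w) ^ 2 + ‖v‖ ^ 2 * l = (inner ℝ v w + l) ^ 2 by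
      rw [show ‖v‖ ^ 2 = l + 2 * inner ℝ v w by linarith]; ring]
    exact Real.sqrt_sq h4

end Algebra

variable {E : Type*} [NormedAddCommGroup E] [NormedSpace ℝ E] [FiniteDimensional ℝ E]
  {M : Type*} [TopologicalSpace M] [ChartedSpace E M] [IsManifold 𝓘(ℝ, E) ∞ M]

/-- The properties of a function on the tangent bundle which make its length functional invariant
under orientation preserving reparametrisations. -/
structure IsLengthIntegrand (F : (x : M) → TangentSpace 𝓘(ℝ, E) x → ℝ) : Prop where
  continuous : Continuous fun z : TangentBundle 𝓘(ℝ, E) M ↦ F z.1 z.2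
  nonneg : ∀ x v, 0 ≤ F x v
  smul : ∀ x v, ∀ c : ℝ, 0 ≤ c → F x (c • v) = c * F x v

variable [RiemannianBundle (fun x : M ↦ TangentSpace 𝓘(ℝ, E) x)]
  [IsContMDiffRiemannianBundle 𝓘(ℝ, E) ∞ E (fun x : M ↦ TangentSpace 𝓘(ℝ, E) x)]

lemma isContinuousRiemannianBundle :
    IsContinuousRiemannianBundle E (fun x : M ↦ TangentSpace 𝓘(ℝ, E) x) := by
  obtain ⟨g, hg, hg'⟩ := IsContMDiffRiemannianBundle.exists_contMDiff (IB := 𝓘(ℝ, E)) (n := ∞)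
    (F := E) (E := fun x : M ↦ TangentSpace 𝓘(ℝ, E) x)
  exact ⟨g, hg.continuous, hg'⟩

lemma continuous_inner_bundle {X : Type*} [TopologicalSpace X] {b : X → M}
    {v w : (x : X) → TangentSpace 𝓘(ℝ, E) (b x)}
    (hv : Continuous (fun x ↦ (⟨b x, v x⟩ : TangentBundle 𝓘(ℝ, E) M)))
    (hw : Continuous (fun x ↦ (⟨b x, w x⟩ : TangentBundle 𝓘(ℝ, E) M))) :
    Continuous (fun x ↦ (inner ℝ (v x) (w x) : ℝ)) :=
  -- explicit instances, as in `contMDiffAt_inner_bundle`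
  @Continuous.inner_bundle M _ E _ _ (fun x ↦ TangentSpace 𝓘(ℝ, E) x) _
    (fun _ ↦ inferInstance) (fun _ ↦ inferInstance) _ _ X _ isContinuousRiemannianBundle b v w hv hw

lemma continuous_norm_bundle :
    Continuous fun z : TangentBundle 𝓘(ℝ, E) M ↦ ‖z.2‖ := by
  have h := continuous_inner_bundle (E := E) (M := M) (b := fun z : TangentBundle 𝓘(ℝ, E) M ↦ z.1)
    (v := fun z ↦ z.2) (w := fun z ↦ z.2) continuous_id continuous_id
  refine h.sqrt.congr fun z ↦ ?_
  rw [real_inner_self_eq_norm_sq, Real.sqrt_sq (norm_nonneg _)]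

lemma isLengthIntegrand_riemannNorm : IsLengthIntegrand (riemannNorm (E := E) (M := M)) where
  continuous := continuous_norm_bundle
  nonneg _ _ := norm_nonneg _
  smul x v c hc := by
    rw [riemannNorm, norm_smul, Real.norm_of_nonneg hc]; rfl

variable {W : (x : M) → TangentSpace 𝓘(ℝ, E) x}

lemma continuous_inner_field
    (hW : ContMDiff 𝓘(ℝ, E) 𝓘(ℝ, E).tangent ∞ (fun x ↦ (⟨x, W x⟩ : TangentBundle 𝓘(ℝ, E) M))) :
    Continuous fun z : TangentBundle 𝓘(ℝ, E) M ↦ (inner ℝ z.2 (W z.1) : ℝ) :=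
  continuous_inner_bundle (E := E) (M := M) (b := fun z : TangentBundle 𝓘(ℝ, E) M ↦ z.1)
    (v := fun z ↦ z.2) (w := fun z ↦ W z.1) continuous_id
    (hW.continuous.comp (FiberBundle.continuous_proj E (fun x : M ↦ TangentSpace 𝓘(ℝ, E) x)))

lemma continuous_norm_field
    (hW : ContMDiff 𝓘(ℝ, E) 𝓘(ℝ, E).tangent ∞ (fun x ↦ (⟨x, W x⟩ : TangentBundle 𝓘(ℝ, E) M))) :
    Continuous fun z : TangentBundle 𝓘(ℝ, E) M ↦ ‖W z.1‖ :=
  continuous_norm_bundle.comp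
    (hW.continuous.comp (FiberBundle.continuous_proj E (fun x : M ↦ TangentSpace 𝓘(ℝ, E) x)))

lemma isLengthIntegrand_randers
    (hW : ContMDiff 𝓘(ℝ, E) 𝓘(ℝ, E).tangent ∞ (fun x ↦ (⟨x, W x⟩ : TangentBundle 𝓘(ℝ, E) M)))
    (hW1 : ∀ x, ‖W x‖ < 1) : IsLengthIntegrand (randers W) where
  continuous := by
    have hl : ∀ x, 0 < 1 - ‖W x‖ ^ 2 := fun x ↦ by nlinarith [norm_nonneg (W x), hW1 x]
    have h1 := continuous_inner_field hW
    have h2 := continuous_norm_field hW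
    have h3 := continuous_norm_bundle (E := E) (M := M)
    exact (h1.neg.add ((h1.pow 2).add ((h3.pow 2).mul (continuous_const.sub (h2.pow 2)))).sqrt).div
      (continuous_const.sub (h2.pow 2)) fun z ↦ (hl z.1).ne'
  nonneg x v := by
    have hl : 0 < 1 - ‖W x‖ ^ 2 := by nlinarith [norm_nonneg (W x), hW1 x]
    refine div_nonneg ?_ hl.le
    have : |inner ℝ v (W x)| ≤ √((inner ℝ v (W x)) ^ 2 + ‖v‖ ^ 2 * (1 - ‖W x‖ ^ 2)) :=
      Real.abs_le_sqrt (by nlinarith [sq_nonneg ‖v‖])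
    linarith [le_abs_self (inner ℝ v (W x))]
  smul x v c hc := by
    simp only [randers]
    rw [real_inner_smul_left, norm_smul, Real.norm_of_nonneg hc,
      show (c * inner ℝ v (W x)) ^ 2 + (c * ‖v‖) ^ 2 * (1 - ‖W x‖ ^ 2) =
        c ^ 2 * ((inner ℝ v (W x)) ^ 2 + ‖v‖ ^ 2 * (1 - ‖W x‖ ^ 2)) by ring,
      Real.sqrt_mul (sq_nonneg c), Real.sqrt_sq hc]
    ring

lemma randers_le_one_iff (hW1 : ∀ x, ‖W x‖ < 1) {x : M} {v : TangentSpace 𝓘(ℝ, E) x} :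
    randers W x v ≤ 1 ↔ ‖v - W x‖ ≤ 1 :=
  randers_formula_le_one_iff (hW1 x)

lemma randers_eq_one_iff (hW1 : ∀ x, ‖W x‖ < 1) {x : M} {v : TangentSpace 𝓘(ℝ, E) x} :
    randers W x v = 1 ↔ ‖v - W x‖ = 1 :=
  randers_formula_eq_one_iff (hW1 x)

end Zermelo

end

section

open Set Filter MeasureTheory
open scoped Topology

namespace Zermelo

variable {E : Type*} [NormedAddCommGroup E] [NormedSpace ℝ E] [FiniteDimensional ℝ E]
  {M : Type*} [TopologicalSpace M] [ChartedSpace E M] [IsManifold 𝓘(ℝ, E) ∞ M]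
  {F : (x : M) → TangentSpace 𝓘(ℝ, E) x → ℝ} {P : (x : M) → TangentSpace 𝓘(ℝ, E) x → Prop}
  {γ η : ℝ → M} {a b c : ℝ}

/-! ### Lengths -/

lemma length_le_integral (hF : IsLengthIntegrand F) (hγ : IsPiecewiseC1 E γ a b) {f : ℝ → ℝ}
    (hf : IntervalIntegrable f volume a b)
    (h : ∀ᶠ t in cofinite, t ∈ Ioo a b → F (γ t) (velocity γ t) ≤ f t) :
    length F γ a b ≤ ∫ t in a..b, f t := by
  refine intervalIntegral.integral_mono_ae_restrict hγ.le (hγ.intervalIntegrable hF.continuous) hf ?_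
  rw [EventuallyLE, ae_restrict_iff' measurableSet_Icc]
  filter_upwards [ae_of_eventually_cofinite (h.and ((eventually_cofinite_ne_real a).and
    (eventually_cofinite_ne_real b)))] with t ht htI
  exact ht.1 ⟨lt_of_le_of_ne htI.1 ht.2.1.symm, lt_of_le_of_ne htI.2 ht.2.2⟩

lemma length_add (hF : IsLengthIntegrand F) (hγ : IsPiecewiseC1 E γ a b)
    (hγ' : IsPiecewiseC1 E γ b c) : length F γ a b + length F γ b c = length F γ a c :=
  intervalIntegral.integral_add_adjacent_intervals (hγ.intervalIntegrable hF.continuous)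
    (hγ'.intervalIntegrable hF.continuous)

lemma length_congr (hab : a ≤ b) (h : EqOn γ η (Ioo a b)) : length F γ a b = length F η a b := by
  refine intervalIntegral.integral_congr_ae ?_
  rw [uIoc_of_le hab]
  filter_upwards [ae_of_eventually_cofinite (eventually_cofinite_ne_real b)] with t ht htI
  have h1 := velocity_congr (E := E)
    (h.eventuallyEq_of_mem (Ioo_mem_nhds htI.1 (lt_of_le_of_ne htI.2 ht)))
  exact congrArg (fun z : TangentBundle 𝓘(ℝ, E) M ↦ F z.1 z.2) h1

lemma length_eq_integral (hγ : IsPiecewiseC1 E γ a b) {f : ℝ → ℝ}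
    (h : ∀ t ∈ Ioo a b, MDifferentiableAt 𝓘(ℝ, ℝ) 𝓘(ℝ, E) γ t → F (γ t) (velocity γ t) = f t) :
    length F γ a b = ∫ t in a..b, f t := by
  refine intervalIntegral.integral_congr_ae ?_
  rw [uIoc_of_le hγ.le]
  filter_upwards [ae_of_eventually_cofinite ((eventually_cofinite_ne_real b).and
    hγ.eventually_mdifferentiableAt)] with t ht htI
  have ht' : t ∈ Ioo a b := ⟨htI.1, lt_of_le_of_ne htI.2 ht.1⟩
  exact h t ht' (ht.2 ht')

/-! ### Curves with restricted velocity -/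

/-- `γ` is piecewise `C¹` on `[a, b]` and its velocity satisfies `P`, with finitely many exceptions. -/
structure HasVelocityIn (P : (x : M) → TangentSpace 𝓘(ℝ, E) x → Prop) (γ : ℝ → M) (a b : ℝ) :
    Prop where
  isPiecewiseC1 : IsPiecewiseC1 E γ a b
  eventually_velocity : ∀ᶠ t in cofinite, t ∈ Ioo a b → P (γ t) (velocity γ t)

/-- One can get from `x` to `y` in time `T` along a curve whose velocity satisfies `P`. -/
def Joins (P : (x : M) → TangentSpace 𝓘(ℝ, E) x → Prop) (x y : M) (T : ℝ) : Prop :=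
  ∃ γ, HasVelocityIn P γ 0 T ∧ γ 0 = x ∧ γ T = y

lemma eventually_velocity_comp {θ : ℝ → ℝ} (hγ : IsPiecewiseC1 E γ a b) (hθ : ContDiff ℝ 1 θ)
    (hmono : StrictMono θ) {A B : ℝ} (hA : θ A = a) (hB : θ B = b) :
    ∀ᶠ u in cofinite, u ∈ Ioo A B →
      velocity (E := E) (γ ∘ θ) u = deriv θ u • velocity (E := E) γ (θ u) := by
  subst hA hB
  filter_upwards [hmono.injective.tendsto_cofinite.eventually hγ.eventually_mdifferentiableAt]
    with u hu huI
  exact (velocity_comp ((hθ.differentiable (by simp)) u).hasDerivAt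
    (hu ⟨hmono huI.1, hmono huI.2⟩)).2

namespace HasVelocityIn

lemma mono {Q : (x : M) → TangentSpace 𝓘(ℝ, E) x → Prop} (h : HasVelocityIn P γ a b)
    (hPQ : ∀ x v, P x v → Q x v) : HasVelocityIn Q γ a b :=
  ⟨h.1, h.2.mono fun _ ht hI ↦ hPQ _ _ (ht hI)⟩

lemma restrict (h : HasVelocityIn P γ a b) {a' b' : ℝ} (ha : a ≤ a') (hab : a' ≤ b')
    (hb : b' ≤ b) : HasVelocityIn P γ a' b' :=
  ⟨h.1.restrict ha hab hb, h.2.mono fun _ ht hI ↦ ht ⟨ha.trans_lt hI.1, hI.2.trans_le hb⟩⟩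

lemma shift (h : HasVelocityIn P γ a b) (s : ℝ) :
    HasVelocityIn P (γ ∘ (· + s)) (a - s) (b - s) := by
  have h1 : ContDiff ℝ 1 (fun t : ℝ ↦ t + s) := contDiff_id.add contDiff_const
  have h2 : StrictMono (fun t : ℝ ↦ t + s) := fun _ _ h ↦ by simpa using h
  have hA : (fun t : ℝ ↦ t + s) (a - s) = a := sub_add_cancel a s
  have hB : (fun t : ℝ ↦ t + s) (b - s) = b := sub_add_cancel b s
  refine ⟨h.1.comp h1 h2 hA hB, ?_⟩
  filter_upwards [eventually_velocity_comp h.1 h1 h2 hA hB,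
    h2.injective.tendsto_cofinite.eventually h.2] with u hu hu' huI
  rw [hu huI, deriv_add_const, deriv_id'', one_smul]
  exact hu' ⟨by linarith [huI.1], by linarith [huI.2]⟩

lemma glue (hγ : HasVelocityIn P γ a b) (hη : HasVelocityIn P η b c) (h : γ b = η b) :
    HasVelocityIn P (glue b γ η) a c := by
  refine ⟨hγ.1.glue hη.1 h, ?_⟩
  filter_upwards [hγ.2, hη.2, eventually_cofinite_ne_real b] with t h1 h2 h3 ht
  rcases lt_or_gt_of_ne h3 with h' | h'
  · exact (congrArg (fun z : TangentBundle 𝓘(ℝ, E) M ↦ P z.1 z.2) (velocity_glue_left h')).mpr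
      (h1 ⟨ht.1, h'⟩)
  · exact (congrArg (fun z : TangentBundle 𝓘(ℝ, E) M ↦ P z.1 z.2) (velocity_glue_right h h')).mpr
      (h2 ⟨h', ht.2⟩)

lemma joins (h : HasVelocityIn P γ a b) : Joins P (γ a) (γ b) (b - a) :=
  ⟨γ ∘ (· + a), by simpa using h.shift a, by simp, by simp⟩

lemma const {x : M} (h : P x 0) (hab : a ≤ b) : HasVelocityIn P (fun _ ↦ x) a b :=
  ⟨isPiecewiseC1_const x hab, Eventually.of_forall fun t _ ↦ by rwa [velocity_const]⟩

end HasVelocityIn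

namespace Joins

variable {x y z : M} {S T : ℝ}

lemma exists_curve (h : Joins P x y T) (a : ℝ) :
    ∃ γ, HasVelocityIn P γ a (a + T) ∧ γ a = x ∧ γ (a + T) = y := by
  obtain ⟨γ, hγ, h0, hT⟩ := h
  refine ⟨γ ∘ (· + -a), ?_, by simp [h0], by simp [hT]⟩
  have := hγ.shift (-a)
  rwa [sub_neg_eq_add, sub_neg_eq_add, zero_add, add_comm T] at this

lemma nonneg (h : Joins P x y T) : 0 ≤ T := by
  obtain ⟨γ, hγ, -⟩ := h
  exact hγ.1.le

lemma trans (h1 : Joins P x y S) (h2 : Joins P y z T) : Joins P x z (S + T) := by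
  obtain ⟨γ, hγ, h0, hS⟩ := h1
  obtain ⟨η, hη, h0', hT⟩ := h2.exists_curve S
  have h := hγ.glue hη (hS.trans h0'.symm)
  refine ⟨_, h, ?_, ?_⟩
  · exact (glue_eqOn_left hγ.1.le).trans h0
  · exact (glue_eqOn_right (hS.trans h0'.symm) hη.1.le).trans hT

lemma mono {Q : (x : M) → TangentSpace 𝓘(ℝ, E) x → Prop} (h : Joins P x y T)
    (hPQ : ∀ x v, P x v → Q x v) : Joins Q x y T := by
  obtain ⟨γ, hγ, h⟩ := h
  exact ⟨γ, hγ.mono hPQ, h⟩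

lemma refl (h : P x 0) (hT : 0 ≤ T) : Joins P x x T := ⟨_, .const h hT, rfl, rfl⟩

end Joins

/-! ### Change of parameter -/

/-- The inverse of the primitive of a function which is bounded below by a positive constant. -/
lemma exists_inverse_primitive {g : ℝ → ℝ} (hg : Continuous g) {κ : ℝ} (hκ : 0 < κ)
    (hgκ : ∀ s, κ ≤ g s) (a : ℝ) :
    ∃ θ : ℝ → ℝ, ContDiff ℝ 1 θ ∧ StrictMono θ ∧ (∀ s, θ (∫ u in a..s, g u) = s) ∧
      ∀ u, HasDerivAt θ (g (θ u))⁻¹ u := by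
  set τ : ℝ → ℝ := fun s ↦ ∫ u in a..s, g u with hτ
  have hd : ∀ s, HasDerivAt τ (g s) s := fun s ↦
    intervalIntegral.integral_hasDerivAt_right (hg.intervalIntegrable _ _)
      hg.stronglyMeasurable.stronglyMeasurableAtFilter hg.continuousAt
  have hpos : ∀ s, 0 < g s := fun s ↦ hκ.trans_le (hgκ s)
  have hmono : StrictMono τ := strictMono_of_deriv_pos fun s ↦ by rw [(hd s).deriv]; exact hpos s
  have hsm : ContDiff ℝ 1 τ := by
    rw [contDiff_one_iff_deriv]
    exact ⟨fun s ↦ (hd s).differentiableAt, by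
      rw [show deriv τ = g from funext fun s ↦ (hd s).deriv]; exact hg⟩
  have hmono2 : Monotone fun s ↦ τ s - κ * s := monotone_of_deriv_nonneg
    (fun s ↦ ((hd s).sub ((hasDerivAt_id s).const_mul κ)).differentiableAt) fun s ↦ by
      have := ((hd s).sub ((hasDerivAt_id s).const_mul κ)).deriv
      have h2 : deriv (fun s ↦ τ s - κ * s) s = g s - κ * 1 := this
      rw [h2]
      linarith [hgκ s]
  have htop : Tendsto τ atTop atTop := by
    refine tendsto_atTop_mono' _ ?_
      (tendsto_atTop_add_const_right _ (τ 0) (tendsto_id.const_mul_atTop hκ))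
    filter_upwards [eventually_ge_atTop 0] with s hs
    have := hmono2 hs
    simp only [id_eq, mul_zero, sub_zero] at this ⊢
    linarith
  have hbot : Tendsto τ atBot atBot := by
    refine tendsto_atBot_mono' _ ?_
      (tendsto_atBot_add_const_right _ (τ 0) (tendsto_id.const_mul_atBot hκ))
    filter_upwards [eventually_le_atBot 0] with s hs
    have := hmono2 hs
    simp only [id_eq, mul_zero, sub_zero] at this ⊢
    linarith
  have hsurj := hsm.continuous.surjective htop hbot
  let e : ℝ ≃o ℝ := hmono.orderIsoOfSurjective τ hsurj
  have hesm : ContDiff ℝ 1 e.toHomeomorph.symm :=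
    e.toHomeomorph.contDiff_symm_deriv (f' := g) (fun s ↦ (hpos s).ne') hd hsm
  refine ⟨e.symm, hesm, e.symm.strictMono, fun s ↦ e.symm_apply_apply s, fun u ↦ ?_⟩
  exact HasDerivAt.of_local_left_inverse hesm.continuous.continuousAt (hd (e.symm u)) (hpos _).ne'
    (Eventually.of_forall fun u ↦ e.apply_symm_apply u)

/-- A curve can be run through with `F`-speed at most `1` in a time arbitrarily close to its
`F`-length. The extra time `κ * (b - a)` avoids dividing by zero where the velocity vanishes. -/
theorem IsPiecewiseC1.joins_length (hF : IsLengthIntegrand F) (hη : IsPiecewiseC1 E η a b) {κ : ℝ}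
    (hκ : 0 < κ) :
    Joins (fun x v ↦ F x v ≤ 1) (η a) (η b) (length F η a b + κ * (b - a)) := by
  induction hη with
  | @append a m b h1 h2 ih1 ih2 =>
    have := ih1.trans ih2
    rw [← length_add hF h1 h2]
    convert this using 1
    ring
  | @piece a b hab h =>
    have hpw := IsPiecewiseC1.piece hab h
    rcases hab.eq_or_lt with rfl | hab'
    · refine Joins.refl ?_ ?_
      · have := hF.smul (η a) 0 0 le_rfl
        rw [smul_zero, zero_mul] at this
        rw [this]
        exact zero_le_one
      · simp [length]
    obtain ⟨w, hw, hwv⟩ := exists_continuousOn_velocity hab' h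
    -- the new parameter is the primitive of `F(η, η') + κ`
    set g : ℝ → ℝ := IccExtend hab fun s : Icc a b ↦ F (w s).1 (w s).2 + κ with hg
    have hgc : Continuous g := by
      refine Continuous.Icc_extend' ?_
      exact (hF.continuous.comp (continuousOn_iff_continuous_domRestrict.1 hw)).add continuous_const
    have hgI : ∀ s ∈ Ioo a b, g s = F (η s) (velocity η s) + κ := by
      intro s hs
      rw [hg, IccExtend_of_mem _ _ (Ioo_subset_Icc_self hs)]
      simp only
      rw [hwv s (Ioo_subset_Icc_self hs)
        ((h.contMDiffAt (Icc_mem_nhds hs.1 hs.2)).mdifferentiableAt (by simp))]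
    have hgκ : ∀ s, κ ≤ g s := fun s ↦ le_add_of_nonneg_left (hF.nonneg _ _)
    obtain ⟨θ, hθ, hmono, hinv, hder⟩ := exists_inverse_primitive hgc hκ hgκ a
    have hlen : length F η a b + κ * (b - a) = ∫ u in a..b, g u := by
      have h1 : ∫ u in a..b, g u = ∫ u in a..b, (F (η u) (velocity η u) + κ) := by
        refine intervalIntegral.integral_congr_ae ?_
        rw [uIoc_of_le hab]
        filter_upwards [ae_of_eventually_cofinite (eventually_cofinite_ne_real b)] with t ht htI
        exact hgI t ⟨htI.1, lt_of_le_of_ne htI.2 ht⟩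
      rw [h1, intervalIntegral.integral_add (hpw.intervalIntegrable hF.continuous)
        (intervalIntegrable_const), intervalIntegral.integral_const, smul_eq_mul, mul_comm κ]
      rfl
    rw [hlen]
    have hθ0 : θ 0 = a := by simpa using hinv a
    refine ⟨η ∘ θ, ⟨hpw.comp hθ hmono hθ0 (hinv b), ?_⟩, by simp [hθ0], by simp [hinv b]⟩
    filter_upwards [eventually_velocity_comp hpw hθ hmono hθ0 (hinv b)] with u hu huI
    have hI : θ u ∈ Ioo a b := ⟨hθ0 ▸ hmono huI.1, (hmono huI.2).trans_eq (hinv b)⟩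
    have hgpos : 0 < g (θ u) := hκ.trans_le (hgκ _)
    rw [hu huI, (hder u).deriv]
    change F (η (θ u)) _ ≤ 1
    rw [hF.smul _ _ _ (inv_nonneg.2 hgpos.le), inv_mul_le_one₀ hgpos, hgI _ hI]
    linarith

end Zermelo

end

section

open Set Filter MeasureTheory Manifold
open scoped Topology

namespace Zermelo

variable {E : Type*} [NormedAddCommGroup E] [NormedSpace ℝ E] [FiniteDimensional ℝ E]
  {M : Type*} [TopologicalSpace M] [ChartedSpace E M] [IsManifold 𝓘(ℝ, E) ∞ M]
  [RiemannianBundle (fun x : M ↦ TangentSpace 𝓘(ℝ, E) x)]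
  [IsContMDiffRiemannianBundle 𝓘(ℝ, E) ∞ E (fun x : M ↦ TangentSpace 𝓘(ℝ, E) x)]
  {W : (x : M) → TangentSpace 𝓘(ℝ, E) x} {γ q : ℝ → M} {a b c : ℝ}

/-! ### Short curves stay close to their initial point -/

lemma IsPiecewiseC1.pathELength_eq (h : IsPiecewiseC1 E γ a b) :
    pathELength 𝓘(ℝ, E) γ a b = ENNReal.ofReal (length (riemannNorm (E := E)) γ a b) := by
  have h1 := h.intervalIntegrable isLengthIntegrand_riemannNorm.continuous
  rw [intervalIntegrable_iff_integrableOn_Ioo_of_le h.le] at h1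
  rw [pathELength_eq_lintegral_mfderiv_Ioo, length, intervalIntegral.integral_of_le h.le,
    integral_Ioc_eq_integral_Ioo, ofReal_integral_eq_lintegral_ofReal h1
      (Eventually.of_forall fun _ ↦ norm_nonneg _)]
  refine lintegral_congr fun t ↦ ?_
  rw [riemannNorm, ofReal_norm]
  rfl

lemma IsPiecewiseC1.riemannianEDist_le (h : IsPiecewiseC1 E γ a b) :
    riemannianEDist 𝓘(ℝ, E) (γ a) (γ b) ≤ pathELength 𝓘(ℝ, E) γ a b := by
  induction h with
  | piece hab h => exact riemannianEDist_le_pathELength h rfl rfl hab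
  | append h1 h2 ih1 ih2 =>
    rw [← pathELength_add h1.le h2.le]
    exact riemannianEDist_triangle.trans (add_le_add ih1 ih2)

/-- A curve that starts near `x` and is short stays near `x`, because the Riemannian distance is at
most the length and induces the topology. -/
theorem exists_forall_mem_of_length_lt [T2Space M] {x : M} {U : Set M} (hU : U ∈ 𝓝 x) :
    ∃ ρ > 0, ∃ V ∈ 𝓝 x, ∀ γ : ℝ → M, ∀ a b : ℝ, IsPiecewiseC1 E γ a b → γ a ∈ V →
      length (riemannNorm (E := E)) γ a b < ρ → ∀ t ∈ Icc a b, γ t ∈ U := by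
  have : LocallyCompactSpace M := Manifold.locallyCompact_of_finiteDimensional 𝓘(ℝ, E)
  have : IsManifold 𝓘(ℝ, E) 1 M := .of_le (n := ∞) (by simp)
  have := isContinuousRiemannianBundle (E := E) (M := M)
  obtain ⟨r, hr, hrU⟩ := setOfPred_riemannianEDist_lt_subset_nhds' 𝓘(ℝ, E) hU
  obtain ⟨ρ, hρ, hρr⟩ := ENNReal.lt_iff_exists_nnreal_btwn.1 (ENNReal.half_pos hr.ne')
  have hρ' : (0 : ℝ) < ρ := by exact_mod_cast hρ
  refine ⟨ρ, hρ', {y | riemannianEDist 𝓘(ℝ, E) x y < r / 2},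
    eventually_riemannianEDist_lt 𝓘(ℝ, E) x (ENNReal.half_pos hr.ne'), ?_⟩
  intro γ a b hγ hγa hlen t ht
  apply hrU
  have h1 := hγ.restrict le_rfl ht.1 ht.2
  have h2 : riemannianEDist 𝓘(ℝ, E) (γ a) (γ t) < r / 2 := by
    refine h1.riemannianEDist_le.trans_lt ((pathELength_mono le_rfl ht.2).trans_lt ?_)
    rw [hγ.pathELength_eq]
    refine lt_trans ?_ hρr
    rw [← ENNReal.ofReal_coe_nnreal]
    exact (ENNReal.ofReal_lt_ofReal_iff hρ').2 hlen
  calc riemannianEDist 𝓘(ℝ, E) x (γ t)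
      ≤ riemannianEDist 𝓘(ℝ, E) x (γ a) + riemannianEDist 𝓘(ℝ, E) (γ a) (γ t) :=
        riemannianEDist_triangle
    _ < r / 2 + r / 2 := ENNReal.add_lt_add hγa h2
    _ = r := ENNReal.add_halves r

/-! ### Trajectories -/

/-- The admissible trajectories are the curves of Randers speed at most `1`; by continuity on the
pieces, finitely many exceptions do not matter. -/
lemma isTrajectory_iff
    (hW : ContMDiff 𝓘(ℝ, E) 𝓘(ℝ, E).tangent ∞ (fun x ↦ (⟨x, W x⟩ : TangentBundle 𝓘(ℝ, E) M)))
    (hW1 : ∀ x, ‖W x‖ < 1) :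
    IsTrajectory W γ a b ↔ HasVelocityIn (fun x v ↦ randers W x v ≤ 1) γ a b := by
  constructor
  · rintro ⟨h1, h2⟩
    refine ⟨h1, ?_⟩
    filter_upwards [h1.eventually_mdifferentiableAt] with t ht htI
    exact (randers_le_one_iff hW1).2 (h2 t htI (ht htI))
  · rintro ⟨h1, h2⟩
    refine ⟨h1, fun t ht hd ↦ (randers_le_one_iff hW1).1 ?_⟩
    have hC : IsClosed {z : TangentBundle 𝓘(ℝ, E) M | randers W z.1 z.2 ≤ 1} :=
      isClosed_le (isLengthIntegrand_randers hW hW1).continuous continuous_const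
    exact h1.mem_of_ae hC (ae_of_eventually_cofinite h2) (ht.1.trans ht.2)
      (Ioo_subset_Icc_self ht) hd

lemma isTimeMinimizing_iff
    (hW : ContMDiff 𝓘(ℝ, E) 𝓘(ℝ, E).tangent ∞ (fun x ↦ (⟨x, W x⟩ : TangentBundle 𝓘(ℝ, E) M)))
    (hW1 : ∀ x, ‖W x‖ < 1) :
    IsTimeMinimizing W q a b ↔ HasVelocityIn (fun x v ↦ randers W x v ≤ 1) q a b ∧
      ∀ T, Joins (fun x v ↦ randers W x v ≤ 1) (q a) (q b) T → b - a ≤ T := by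
  rw [IsTimeMinimizing, isTrajectory_iff hW hW1]
  refine and_congr_right fun _ ↦ forall_congr' fun T ↦ ?_
  simp only [isTrajectory_iff hW hW1]
  exact ⟨fun h ⟨γ, h1, h2, h3⟩ ↦ h γ h1 h2 h3, fun h γ h1 h2 h3 ↦ h ⟨γ, h1, h2, h3⟩⟩

lemma IsTimeMinimizing.restrict
    (hW : ContMDiff 𝓘(ℝ, E) 𝓘(ℝ, E).tangent ∞ (fun x ↦ (⟨x, W x⟩ : TangentBundle 𝓘(ℝ, E) M)))
    (hW1 : ∀ x, ‖W x‖ < 1) (h : IsTimeMinimizing W q a b) {a' b' : ℝ} (ha : a ≤ a')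
    (hab : a' ≤ b') (hb : b' ≤ b) : IsTimeMinimizing W q a' b' := by
  rw [isTimeMinimizing_iff hW hW1] at h ⊢
  refine ⟨h.1.restrict ha hab hb, fun T hT ↦ ?_⟩
  have h1 := (h.1.restrict le_rfl ha (hab.trans hb)).joins
  have h2 := (h.1.restrict (ha.trans hab) hb le_rfl).joins
  have := h.2 _ ((h1.trans hT).trans h2)
  linarith

lemma IsLengthMinimizing.restrict {F : (x : M) → TangentSpace 𝓘(ℝ, E) x → ℝ}
    (hF : IsLengthIntegrand F) (h : IsLengthMinimizing F q a b) {a' b' : ℝ} (ha : a ≤ a')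
    (hab : a' ≤ b') (hb : b' ≤ b) : IsLengthMinimizing F q a' b' := by
  have h1 := h.1.restrict le_rfl ha (hab.trans hb)
  have h2 := h.1.restrict ha hab hb
  have h3 := h.1.restrict (ha.trans hab) hb le_rfl
  refine ⟨h2, fun η hη hηa hηb ↦ ?_⟩
  -- the competitor, extended by the curve itself to the larger interval
  set ζ : ℝ → M := glue a' q (glue b' η q)
  have e1 : EqOn (glue b' η q) η (Iic b') := glue_eqOn_left
  have e2 : EqOn (glue b' η q) q (Ici b') := glue_eqOn_right hηb
  have e3 : EqOn ζ q (Iic a') := glue_eqOn_left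
  have e4 : EqOn ζ (glue b' η q) (Ici a') := glue_eqOn_right ((e1 hab).trans hηa).symm
  have z1 : EqOn ζ q (Icc a a') := fun t ht ↦ e3 ht.2
  have z2 : EqOn ζ η (Icc a' b') := fun t ht ↦ (e4 ht.1).trans (e1 ht.2)
  have z3 : EqOn ζ q (Icc b' b) := fun t ht ↦ (e4 (hab.trans ht.1)).trans (e2 ht.1)
  have p1 := h1.congr z1
  have p2 := hη.congr z2
  have p3 := h3.congr z3
  have key := h.2 ζ ((p1.append p2).append p3) (z1 ⟨le_rfl, ha⟩) (z3 ⟨hb, le_rfl⟩)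
  rw [← length_add hF (h1.append h2) h3, ← length_add hF h1 h2,
    ← length_add hF (p1.append p2) p3, ← length_add hF p1 p2,
    length_congr ha (z1.mono Ioo_subset_Icc_self), length_congr hab (z2.mono Ioo_subset_Icc_self),
    length_congr hb (z3.mono Ioo_subset_Icc_self)] at key
  linarith

/-! ### Time-minimising curves are the unit speed Randers geodesics -/

/-- The Randers length is the infimum of the possible travel times, so a time-minimising curve
minimises Randers length. -/
lemma IsTimeMinimizing.length_randers
    (hW : ContMDiff 𝓘(ℝ, E) 𝓘(ℝ, E).tangent ∞ (fun x ↦ (⟨x, W x⟩ : TangentBundle 𝓘(ℝ, E) M)))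
    (hW1 : ∀ x, ‖W x‖ < 1) (h : IsTimeMinimizing W q a b) :
    length (randers W) q a b = b - a ∧ IsLengthMinimizing (randers W) q a b := by
  have hF := isLengthIntegrand_randers hW hW1
  rw [isTimeMinimizing_iff hW hW1] at h
  obtain ⟨h1, h2⟩ := h
  have hle : length (randers W) q a b ≤ b - a := by
    have := length_le_integral hF h1.1 (f := fun _ ↦ 1) intervalIntegrable_const h1.2
    simpa using this
  have hge : ∀ η : ℝ → M, IsPiecewiseC1 E η a b → η a = q a → η b = q b →
      b - a ≤ length (randers W) η a b := by
    intro η hη hηa hηb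
    refine le_of_forall_pos_le_add fun ε hε ↦ ?_
    have hab : 0 ≤ b - a := sub_nonneg.2 hη.le
    have hκ : 0 < ε / (b - a + 1) := by positivity
    have h3 := hη.joins_length hF hκ
    rw [hηa, hηb] at h3
    refine (h2 _ h3).trans ?_
    gcongr
    rw [div_mul_eq_mul_div, div_le_iff₀ (by positivity)]
    nlinarith
  exact ⟨hle.antisymm (hge q h1.1 rfl rfl), h1.1, fun η hη hηa hηb ↦
    hle.trans (hge η hη hηa hηb)⟩

/-- A time-minimising curve always moves at full speed. -/
lemma IsTimeMinimizing.randers_eq_one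
    (hW : ContMDiff 𝓘(ℝ, E) 𝓘(ℝ, E).tangent ∞ (fun x ↦ (⟨x, W x⟩ : TangentBundle 𝓘(ℝ, E) M)))
    (hW1 : ∀ x, ‖W x‖ < 1) (h : IsTimeMinimizing W q a b) {t : ℝ} (ht : t ∈ Ioo a b)
    (hd : MDifferentiableAt 𝓘(ℝ, ℝ) 𝓘(ℝ, E) q t) : randers W (q t) (velocity q t) = 1 := by
  have hF := isLengthIntegrand_randers hW hW1
  have hlen := (h.length_randers hW hW1).1
  rw [isTimeMinimizing_iff hW hW1] at h
  obtain ⟨h1, -⟩ := h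
  have hab := h1.1.le
  have hint := h1.1.intervalIntegrable hF.continuous
  -- the integrand is at most one and its integral is the length of the interval
  have hzero : ∫ s in a..b, (1 - randers W (q s) (velocity q s)) = 0 := by
    rw [intervalIntegral.integral_sub intervalIntegrable_const hint]
    change _ - length (randers W) q a b = 0
    rw [hlen]
    simp
  have hnn : 0 ≤ᵐ[volume.restrict (Ioc a b)] fun s ↦ 1 - randers W (q s) (velocity q s) := by
    rw [EventuallyLE, ae_restrict_iff' measurableSet_Ioc]
    filter_upwards [ae_of_eventually_cofinite (h1.2.and (eventually_cofinite_ne_real b))]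
      with s hs hsI
    exact sub_nonneg.2 (hs.1 ⟨hsI.1, lt_of_le_of_ne hsI.2 hs.2⟩)
  rw [intervalIntegral.integral_eq_zero_iff_of_le_of_nonneg_ae hab hnn
    (intervalIntegrable_const.sub hint), EventuallyEq, ae_restrict_iff' measurableSet_Ioc] at hzero
  have hC : IsClosed {z : TangentBundle 𝓘(ℝ, E) M | randers W z.1 z.2 = 1} :=
    isClosed_eq hF.continuous continuous_const
  refine h1.1.mem_of_ae hC ?_ (ht.1.trans ht.2) (Ioo_subset_Icc_self ht) hd
  filter_upwards [hzero] with s hs hsI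
  exact (sub_eq_zero.1 (hs ⟨hsI.1, hsI.2.le⟩)).symm

/-- A faster trajectory, reparametrised over the same interval, would be a shorter curve. -/
lemma IsLengthMinimizing.isTimeMinimizing
    (hW : ContMDiff 𝓘(ℝ, E) 𝓘(ℝ, E).tangent ∞ (fun x ↦ (⟨x, W x⟩ : TangentBundle 𝓘(ℝ, E) M)))
    (hW1 : ∀ x, ‖W x‖ < 1) (h : IsLengthMinimizing (randers W) q a b)
    (h1 : HasSpeedOn (randers W) q (fun _ ↦ 1) (Ioo a b)) : IsTimeMinimizing W q a b := by
  have hF := isLengthIntegrand_randers hW hW1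
  rw [isTimeMinimizing_iff hW hW1]
  have hlen : length (randers W) q a b = b - a := by
    rw [length_eq_integral h.1 h1]
    simp
  refine ⟨⟨h.1, ?_⟩, fun T hT ↦ ?_⟩
  · filter_upwards [h.1.eventually_mdifferentiableAt] with t ht htI
    exact (h1 t htI (ht htI)).le
  by_contra! hlt
  -- the faster trajectory, made a little slower if it takes no time at all
  obtain ⟨S, hTS, hS⟩ := exists_between hlt
  have hS0 : 0 < S := hT.nonneg.trans_lt hTS
  have hab : 0 < b - a := hS0.trans hS
  have hwait : randers W (q b) 0 ≤ 1 := by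
    rw [randers_le_one_iff hW1, zero_sub, norm_neg]
    exact (hW1 _).le
  have hT' := hT.trans (Joins.refl hwait (sub_nonneg.2 hTS.le))
  rw [add_sub_cancel] at hT'
  obtain ⟨γ, hγ, hγ0, hγS⟩ := hT'
  set k : ℝ := S / (b - a) with hk
  have hk0 : 0 < k := by positivity
  have hθ : ContDiff ℝ 1 fun t : ℝ ↦ k * (t - a) := by fun_prop
  have hmono : StrictMono fun t : ℝ ↦ k * (t - a) := fun s t hst ↦ by
    simp only; gcongr
  have hA : k * (a - a) = 0 := by ring
  have hB : k * (b - a) = S := by rw [hk]; field_simp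
  have hd : ∀ t, deriv (fun t : ℝ ↦ k * (t - a)) t = k := fun t ↦ by
    have := ((hasDerivAt_id t).sub_const a).const_mul k
    simpa only [id_eq, mul_one] using this.deriv
  have hpw := hγ.1.comp hθ hmono hA hB
  have hle : length (randers W) (γ ∘ fun t ↦ k * (t - a)) a b ≤ ∫ t in a..b, k := by
    refine length_le_integral hF hpw intervalIntegrable_const ?_
    filter_upwards [eventually_velocity_comp hγ.1 hθ hmono hA hB,
      hmono.injective.tendsto_cofinite.eventually hγ.2] with t ht1 ht2 htI
    rw [ht1 htI, hd]
    have h3 := ht2 ⟨hA ▸ hmono htI.1, (hmono htI.2).trans_eq hB⟩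
    change randers W (γ (k * (t - a))) _ ≤ k
    rw [hF.smul _ _ _ hk0.le]
    nlinarith
  have h4 := h.2 _ hpw (by simp [hγ0]) (by simp only [Function.comp, hB, hγS])
  rw [hlen] at h4
  rw [intervalIntegral.integral_const, smul_eq_mul, mul_comm, hB] at hle
  linarith

theorem isLocallyTimeMinimizingOn_iff
    (hW : ContMDiff 𝓘(ℝ, E) 𝓘(ℝ, E).tangent ∞ (fun x ↦ (⟨x, W x⟩ : TangentBundle 𝓘(ℝ, E) M)))
    (hW1 : ∀ x, ‖W x‖ < 1) {J : Set ℝ} :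
    IsLocallyTimeMinimizingOn W q J ↔
      IsGeodesicOn (randers W) q J ∧ HasSpeedOn (randers W) q (fun _ ↦ 1) J := by
  constructor
  · intro h
    refine ⟨fun c hc ↦ ?_, fun c hc hd ↦ ?_⟩
    · obtain ⟨δ, hδ, hJ, hm⟩ := h c hc
      exact ⟨δ, hδ, hJ, (hm.length_randers hW hW1).2⟩
    · obtain ⟨δ, hδ, hJ, hm⟩ := h c hc
      exact hm.randers_eq_one hW hW1 ⟨by linarith, by linarith⟩ hd
  · rintro ⟨h1, h2⟩ c hc
    obtain ⟨δ, hδ, hJ, hm⟩ := h1 c hc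
    exact ⟨δ, hδ, hJ, hm.isTimeMinimizing hW hW1
      fun t ht ↦ h2 t (hJ (Ioo_subset_Icc_self ht))⟩

end Zermelo

end

/-! ### Curves dragged by the wind -/

section

open Set Filter MeasureTheory
open scoped Topology

namespace Zermelo

variable {E : Type*} [NormedAddCommGroup E] [NormedSpace ℝ E] [FiniteDimensional ℝ E]
  {M : Type*} [TopologicalSpace M] [T2Space M] [ChartedSpace E M] [IsManifold 𝓘(ℝ, E) ∞ M]
  {W : (x : M) → TangentSpace 𝓘(ℝ, E) x} {p q γ : ℝ → M} {a b c t : ℝ} {J : Set ℝ}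

lemma contMDiff_neg_field
    (hW : ContMDiff 𝓘(ℝ, E) 𝓘(ℝ, E).tangent ∞ (fun x ↦ (⟨x, W x⟩ : TangentBundle 𝓘(ℝ, E) M))) :
    ContMDiff 𝓘(ℝ, E) 𝓘(ℝ, E).tangent ∞ (fun x ↦ (⟨x, (-W) x⟩ : TangentBundle 𝓘(ℝ, E) M)) :=
  ContMDiff.neg_section hW

/-- At the times in `J` the point `q t` is where the wind has carried `p t` in time `t`: the curve
`p` is `q` seen from a frame moving with the wind. -/
def IsDragged (W : (x : M) → TangentSpace 𝓘(ℝ, E) x) (p q : ℝ → M) (J : Set ℝ) : Prop :=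
  ∀ t ∈ J, (t, p t) ∈ flowDomain W ∧ flow W t (p t) = q t

namespace IsDragged

lemma symm
    (hW : ContMDiff 𝓘(ℝ, E) 𝓘(ℝ, E).tangent ∞ (fun x ↦ (⟨x, W x⟩ : TangentBundle 𝓘(ℝ, E) M)))
    (h : IsDragged W p q J) : IsDragged (-W) q p J := fun t ht ↦ by
  obtain ⟨h1, h2⟩ := h t ht
  obtain ⟨h3, h4⟩ := flow_neg_flow hW h1
  rw [h2] at h3 h4
  exact ⟨mem_flowDomain_neg.2 h3, (flow_neg hW h3).trans h4⟩

lemma mono (h : IsDragged W p q J) {J' : Set ℝ} (hJ : J' ⊆ J) : IsDragged W p q J' :=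
  fun t ht ↦ h t (hJ ht)

lemma of_neg
    (hW : ContMDiff 𝓘(ℝ, E) 𝓘(ℝ, E).tangent ∞ (fun x ↦ (⟨x, W x⟩ : TangentBundle 𝓘(ℝ, E) M)))
    (h : IsDragged (-W) q p J) : IsDragged W p q J := by
  have := h.symm (contMDiff_neg_field hW)
  rwa [neg_neg] at this

lemma isPiecewiseC1
    (hW : ContMDiff 𝓘(ℝ, E) 𝓘(ℝ, E).tangent ∞ (fun x ↦ (⟨x, W x⟩ : TangentBundle 𝓘(ℝ, E) M)))
    (h : IsDragged W p q (Icc a b)) (hp : IsPiecewiseC1 E p a b) : IsPiecewiseC1 E q a b := by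
  induction hp with
  | @piece a b hab hp =>
    refine .piece hab fun t ht ↦ ?_
    have h1 : ContMDiffWithinAt 𝓘(ℝ, ℝ) (𝓘(ℝ, ℝ).prod 𝓘(ℝ, E)) 1 (fun s ↦ (s, p s)) (Icc a b) t :=
      contMDiffWithinAt_id.prodMk (hp t ht)
    have h2 := ContMDiffAt.comp_contMDiffWithinAt t (contMDiffAt_flow hW (h t ht).1) h1
    exact h2.congr (fun s hs ↦ (h s hs).2.symm) (h t ht).2.symm
  | append h1 h2 ih1 ih2 =>
    exact .append (ih1 (h.mono (Icc_subset_Icc_right h2.le)))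
      (ih2 (h.mono (Icc_subset_Icc_left h1.le)))

lemma mdifferentiableAt
    (hW : ContMDiff 𝓘(ℝ, E) 𝓘(ℝ, E).tangent ∞ (fun x ↦ (⟨x, W x⟩ : TangentBundle 𝓘(ℝ, E) M)))
    (h : IsDragged W p q J) (hJ : J ∈ 𝓝 t) (hp : MDifferentiableAt 𝓘(ℝ, ℝ) 𝓘(ℝ, E) p t) :
    MDifferentiableAt 𝓘(ℝ, ℝ) 𝓘(ℝ, E) q t :=
  (velocity_flow hW (h t (mem_of_mem_nhds hJ)).1 hp).1.congr_of_eventuallyEq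
    (by filter_upwards [hJ] with s hs using (h s hs).2.symm)

variable [RiemannianBundle (fun x : M ↦ TangentSpace 𝓘(ℝ, E) x)]
  [IsContMDiffRiemannianBundle 𝓘(ℝ, E) ∞ E (fun x : M ↦ TangentSpace 𝓘(ℝ, E) x)]

/-- The velocity in the moving frame is the control, up to the scale factor of the homothety. -/
lemma norm_velocity
    (hW : ContMDiff 𝓘(ℝ, E) 𝓘(ℝ, E).tangent ∞ (fun x ↦ (⟨x, W x⟩ : TangentBundle 𝓘(ℝ, E) M)))
    {σ : ℝ} (hσ : IsInfinitesimalHomothety W σ) (h : IsDragged W p q J) (hJ : J ∈ 𝓝 t)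
    (hp : MDifferentiableAt 𝓘(ℝ, ℝ) 𝓘(ℝ, E) p t) :
    ‖velocity (E := E) p t‖ = Real.exp (-σ * t / 2) * ‖velocity (E := E) q t - W (q t)‖ := by
  have h1 := norm_velocity_flow_sub hW hσ (h t (mem_of_mem_nhds hJ)).1 hp
  have h2 : q =ᶠ[𝓝 t] fun s ↦ flow W s (p s) := by
    filter_upwards [hJ] with s hs using (h s hs).2.symm
  have h3 : ‖velocity (E := E) q t - W (q t)‖ =
      ‖velocity (E := E) (fun s ↦ flow W s (p s)) t - W (flow W t (p t))‖ :=
    congrArg (fun z : TangentBundle 𝓘(ℝ, E) M ↦ ‖z.2 - W z.1‖) (velocity_congr h2)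
  rw [h3, h1, ← mul_assoc, ← Real.exp_add,
    show -σ * t / 2 + σ * t / 2 = 0 by ring, Real.exp_zero, one_mul]

end IsDragged

lemma isDragged_flow (h : ∀ t ∈ J, (t, p t) ∈ flowDomain W) :
    IsDragged W p (fun t ↦ flow W t (p t)) J := fun t ht ↦ ⟨h t ht, rfl⟩

lemma exists_forall_mem_flowDomain
    (hW : ContMDiff 𝓘(ℝ, E) 𝓘(ℝ, E).tangent ∞ (fun x ↦ (⟨x, W x⟩ : TangentBundle 𝓘(ℝ, E) M)))
    {x : M} (h : (c, x) ∈ flowDomain W) :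
    ∃ κ > 0, ∃ U ∈ 𝓝 x, ∀ t ∈ Ioo (c - κ) (c + κ), ∀ y ∈ U, (t, y) ∈ flowDomain W := by
  obtain ⟨I, hI, U, hU, hIU⟩ := mem_nhds_prod_iff.1 ((isOpen_flowDomain hW).mem_nhds h)
  obtain ⟨κ, hκ, hκI⟩ := Metric.mem_nhds_iff.1 hI
  rw [Real.ball_eq_Ioo] at hκI
  exact ⟨κ, hκ, U, hU, fun t ht y hy ↦ hIU ⟨hκI ht, hy⟩⟩

/-- Dragging a curve by the wind is possible for short times. -/
lemma exists_forall_mem_flowDomain_of_continuousAt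
    (hW : ContMDiff 𝓘(ℝ, E) 𝓘(ℝ, E).tangent ∞ (fun x ↦ (⟨x, W x⟩ : TangentBundle 𝓘(ℝ, E) M)))
    (hp : ContinuousAt p 0) {ε : ℝ} (hε : 0 < ε) :
    ∃ r : ℝ, 0 < r ∧ r ≤ ε ∧ ∀ t ∈ Ioo (-r) r, (t, p t) ∈ flowDomain W := by
  have h : ∀ᶠ t in 𝓝 (0 : ℝ), (t, p t) ∈ flowDomain W :=
    (continuousAt_id.prodMk hp).eventually
      ((isOpen_flowDomain hW).mem_nhds (mem_flowDomain_zero hW (p 0)))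
  obtain ⟨r, hr, hrI⟩ := Metric.mem_nhds_iff.1 h
  rw [Real.ball_zero_eq_Ioo] at hrI
  refine ⟨min r ε, lt_min hr hε, min_le_right _ _, fun t ht ↦ hrI ⟨?_, ?_⟩⟩
  · linarith [ht.1, min_le_left r ε]
  · exact ht.2.trans_le (min_le_left _ _)

lemma IsPiecewiseC1.continuousAt (h : IsPiecewiseC1 E p a b) (ht : t ∈ Ioo a b) :
    ContinuousAt p t := h.continuousOn.continuousAt (Icc_mem_nhds ht.1 ht.2)

variable [RiemannianBundle (fun x : M ↦ TangentSpace 𝓘(ℝ, E) x)]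
  [IsContMDiffRiemannianBundle 𝓘(ℝ, E) ∞ E (fun x : M ↦ TangentSpace 𝓘(ℝ, E) x)]

lemma velocity_flow_line
    (hW : ContMDiff 𝓘(ℝ, E) 𝓘(ℝ, E).tangent ∞ (fun x ↦ (⟨x, W x⟩ : TangentBundle 𝓘(ℝ, E) M)))
    {x : M} {k s : ℝ} (h : (k * t + s, x) ∈ flowDomain W) :
    velocity (E := E) (fun t ↦ flow W (k * t + s) x) t = k • W (flow W (k * t + s) x) := by
  have h1 := hasMFDerivAt_flow_time hW h
  have h2 : HasDerivAt (fun t : ℝ ↦ k * t + s) k t := by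
    simpa using ((hasDerivAt_id t).const_mul k).add_const s
  refine (velocity_comp (γ := fun t ↦ flow W t x) h2 h1.mdifferentiableAt).2.trans ?_
  refine congrArg (k • ·) ?_
  unfold velocity
  rw [h1.mfderiv]
  exact one_smul ℝ (W (flow W (k * t + s) x))

/-- Following the wind with twice its speed is admissible, and halves the travel time. -/
lemma joins_flow
    (hW : ContMDiff 𝓘(ℝ, E) 𝓘(ℝ, E).tangent ∞ (fun x ↦ (⟨x, W x⟩ : TangentBundle 𝓘(ℝ, E) M)))
    (hW1 : ∀ x, ‖W x‖ < 1) {x : M} (hab : a ≤ b) (h : ∀ t ∈ Icc a b, (t, x) ∈ flowDomain W) :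
    Joins (fun x v ↦ randers W x v ≤ 1) (flow W a x) (flow W b x) ((b - a) / 2) := by
  have hD : ∀ t ∈ Icc a ((a + b) / 2), (2 * t + -a, x) ∈ flowDomain W := fun t ht ↦
    h _ ⟨by linarith [ht.1], by linarith [ht.2]⟩
  have h1 : HasVelocityIn (fun x v ↦ randers W x v ≤ 1) (fun t ↦ flow W (2 * t + -a) x) a
      ((a + b) / 2) := by
    refine ⟨.piece (by linarith) fun t ht ↦ ?_, Eventually.of_forall fun t ht ↦ ?_⟩
    · have h2 : ContMDiffAt 𝓘(ℝ, ℝ) (𝓘(ℝ, ℝ).prod 𝓘(ℝ, E)) 1 (fun s : ℝ ↦ (2 * s + -a, x)) t := by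
        refine ContMDiffAt.prodMk (ContDiff.contMDiff ?_).contMDiffAt contMDiffAt_const
        fun_prop
      exact (ContMDiffAt.comp t (contMDiffAt_flow hW (hD t ht)) h2).contMDiffWithinAt
    · rw [randers_le_one_iff hW1, velocity_flow_line hW (hD t (Ioo_subset_Icc_self ht)), two_smul,
        add_sub_cancel_right]
      exact (hW1 _).le
  have h2 := h1.joins
  rw [show 2 * a + -a = a by ring, show 2 * ((a + b) / 2) + -a = b by ring,
    show (a + b) / 2 - a = (b - a) / 2 by ring] at h2
  exact h2

end Zermelo

end

/-! ### Time-minimising curves and Riemannian geodesics -/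

section

open Set Filter MeasureTheory
open scoped Topology

namespace Zermelo

variable {E : Type*} [NormedAddCommGroup E] [NormedSpace ℝ E] [FiniteDimensional ℝ E]
  {M : Type*} [TopologicalSpace M] [T2Space M] [ChartedSpace E M] [IsManifold 𝓘(ℝ, E) ∞ M]
  [RiemannianBundle (fun x : M ↦ TangentSpace 𝓘(ℝ, E) x)]
  [IsContMDiffRiemannianBundle 𝓘(ℝ, E) ∞ E (fun x : M ↦ TangentSpace 𝓘(ℝ, E) x)]
  {W : (x : M) → TangentSpace 𝓘(ℝ, E) x} {p q γ : ℝ → M} {a b c t : ℝ} {J : Set ℝ} {σ : ℝ}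

lemma continuous_exp_mul_div_two (σ : ℝ) : Continuous fun t : ℝ ↦ Real.exp (-σ * t / 2) := by
  fun_prop

/-- The primitive of `t ↦ e ^ (-σ t / 2)` is a change of parameter. -/
lemma integral_exp_mul_div_two (σ a : ℝ) :
    ContDiff ℝ 1 (fun t ↦ ∫ u in a..t, Real.exp (-σ * u / 2)) ∧
      StrictMono (fun t ↦ ∫ u in a..t, Real.exp (-σ * u / 2)) ∧
      ∀ t, deriv (fun t ↦ ∫ u in a..t, Real.exp (-σ * u / 2)) t = Real.exp (-σ * t / 2) := by
  have hg := continuous_exp_mul_div_two σ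
  have hd : ∀ t, deriv (fun t ↦ ∫ u in a..t, Real.exp (-σ * u / 2)) t = Real.exp (-σ * t / 2) :=
    fun t ↦ hg.deriv_integral _ a t
  refine ⟨?_, strictMono_of_deriv_pos fun t ↦ by rw [hd]; exact Real.exp_pos _, hd⟩
  rw [contDiff_one_iff_deriv]
  refine ⟨fun t ↦ differentiableAt_of_deriv_ne_zero (by rw [hd]; exact (Real.exp_pos _).ne'), ?_⟩
  rw [funext hd]
  exact hg

/-- A curve of length less than `∫ₐᵇ e ^ (-σ t / 2) dt` can be run through with speed at most
`e ^ (-σ t / 2)`, starting at time `a` and arriving before time `b`. -/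
lemma Joins.exists_curve_exp {x y : M} {T : ℝ}
    (h : Joins (fun x v ↦ riemannNorm (E := E) (M := M) x v ≤ 1) x y T) (hab : a ≤ b)
    (hT : T < ∫ u in a..b, Real.exp (-σ * u / 2)) :
    ∃ b' ∈ Ico a b, ∃ γ : ℝ → M, IsPiecewiseC1 E γ a b' ∧ γ a = x ∧ γ b' = y ∧
      ∀ᶠ t in cofinite, t ∈ Ioo a b' →
        ‖velocity (E := E) γ t‖ ≤ Real.exp (-σ * t / 2) := by
  have hT0 := h.nonneg
  obtain ⟨γ, hγ, hγ0, hγT⟩ := h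
  obtain ⟨h1, h2, h3⟩ := integral_exp_mul_div_two σ a
  have hA : ∫ u in a..a, Real.exp (-σ * u / 2) = 0 := intervalIntegral.integral_same
  obtain ⟨b', hb', hB⟩ := intermediate_value_Icc hab h1.continuous.continuousOn
    (show T ∈ Icc _ _ from ⟨hA.trans_le hT0, hT.le⟩)
  refine ⟨b', ⟨hb'.1, lt_of_le_of_ne hb'.2 ?_⟩, _, hγ.1.comp h1 h2 hA hB, ?_, ?_, ?_⟩
  · rintro rfl
    exact hT.ne' hB
  · exact (congrArg γ hA).trans hγ0
  · exact (congrArg γ hB).trans hγT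
  · filter_upwards [eventually_velocity_comp hγ.1 h1 h2 hA hB,
      h2.injective.tendsto_cofinite.eventually hγ.2] with t ht1 ht2 htI
    have h4 := ht2 ⟨hA.symm.trans_lt (h2 htI.1), (h2 htI.2).trans_eq hB⟩
    rw [ht1 htI, norm_smul, h3, Real.norm_of_nonneg (Real.exp_pos _).le]
    exact mul_le_of_le_one_right (Real.exp_pos _).le h4

/-- Full speed relative to the wind is the speed `e ^ (-σ t / 2)` in the moving frame. -/
lemma IsDragged.speed
    (hW : ContMDiff 𝓘(ℝ, E) 𝓘(ℝ, E).tangent ∞ (fun x ↦ (⟨x, W x⟩ : TangentBundle 𝓘(ℝ, E) M)))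
    (hW1 : ∀ x, ‖W x‖ < 1) (hσ : IsInfinitesimalHomothety W σ) (h : IsDragged W p q J)
    (hJ : IsOpen J) :
    HasSpeedOn (riemannNorm (E := E)) p (fun t ↦ Real.exp (-σ * t / 2)) J ↔
      HasSpeedOn (randers W) q (fun _ ↦ 1) J := by
  constructor
  · intro hs t ht hd
    have hd' := (h.symm hW).mdifferentiableAt (contMDiff_neg_field hW) (hJ.mem_nhds ht) hd
    have h1 : ‖velocity (E := E) p t‖ = _ := hs t ht hd'
    rw [h.norm_velocity hW hσ (hJ.mem_nhds ht) hd'] at h1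
    exact (randers_eq_one_iff hW1).2 (mul_eq_left₀ (Real.exp_pos _).ne' |>.1 h1)
  · intro hs t ht hd
    have h1 := hs t ht (h.mdifferentiableAt hW (hJ.mem_nhds ht) hd)
    rw [randers_eq_one_iff hW1] at h1
    rw [riemannNorm, h.norm_velocity hW hσ (hJ.mem_nhds ht) hd, h1, mul_one]

/-- Seen from the frame moving with the wind, time-minimising curves minimise length locally. -/
lemma IsDragged.exists_isLengthMinimizing
    (hW : ContMDiff 𝓘(ℝ, E) 𝓘(ℝ, E).tangent ∞ (fun x ↦ (⟨x, W x⟩ : TangentBundle 𝓘(ℝ, E) M)))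
    (hW1 : ∀ x, ‖W x‖ < 1) (hσ : IsInfinitesimalHomothety W σ) {δ₀ : ℝ} (hδ₀ : 0 < δ₀)
    (h : IsDragged W p q (Icc (c - δ₀) (c + δ₀)))
    (hq : IsTimeMinimizing W q (c - δ₀) (c + δ₀)) :
    ∃ δ > 0, δ ≤ δ₀ ∧ IsLengthMinimizing (riemannNorm (E := E)) p (c - δ) (c + δ) := by
  have hg := continuous_exp_mul_div_two σ
  have hp : IsPiecewiseC1 E p (c - δ₀) (c + δ₀) :=
    (h.symm hW).isPiecewiseC1 (contMDiff_neg_field hW) hq.1.1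
  obtain ⟨κ, hκ, U, hU, hκU⟩ := exists_forall_mem_flowDomain hW
    (h c ⟨by linarith, by linarith⟩).1
  obtain ⟨ρ, hρ, V, hV, hUV⟩ := exists_forall_mem_of_length_lt (E := E) hU
  -- `δ` is taken so small that the competing curves stay in `U`, where the flow is defined at all
  -- times of the interval
  have e1 : ∀ᶠ δ in 𝓝 (0 : ℝ), p (c - δ) ∈ V := by
    have h1 : ContinuousAt (fun δ : ℝ ↦ c - δ) 0 := by fun_prop
    have h2 := hp.continuousAt (t := c) ⟨by linarith, by linarith⟩
    rw [← sub_zero c] at h2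
    have h3 : Tendsto (fun δ : ℝ ↦ p (c - δ)) (𝓝 0) (𝓝 (p (c - 0))) := h2.comp h1
    rw [sub_zero] at h3
    exact h3 hV
  have e2 : ∀ᶠ δ in 𝓝 (0 : ℝ), ∫ u in (c - δ)..(c + δ), Real.exp (-σ * u / 2) < ρ := by
    have h1 : ContinuousAt (fun δ : ℝ ↦ (∫ u in (0)..(c + δ), Real.exp (-σ * u / 2)) -
        ∫ u in (0)..(c - δ), Real.exp (-σ * u / 2)) 0 := by
      have h2 := (integral_exp_mul_div_two σ 0).1.continuous
      exact ((h2.comp (continuous_const.add continuous_id)).sub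
        (h2.comp (continuous_const.sub continuous_id))).continuousAt
    have h3 := h1.tendsto.eventually (eventually_lt_nhds (b := ρ) (by simpa using hρ))
    refine h3.mono fun δ hδ ↦ ?_
    rwa [intervalIntegral.integral_interval_sub_left (hg.intervalIntegrable _ _)
      (hg.intervalIntegrable _ _)] at hδ
  obtain ⟨δ, ⟨⟨hV', hρ'⟩, hδκ, hδδ₀⟩, hδ⟩ := (((e1.and e2).and ((eventually_lt_nhds hκ).and
    (eventually_le_nhds hδ₀))).filter_mono nhdsWithin_le_nhds |>.and
      (eventually_mem_nhdsWithin (a := (0 : ℝ)) (s := Ioi 0))).exists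
  rw [mem_Ioi] at hδ
  refine ⟨δ, hδ, hδδ₀, ?_⟩
  have hsub : Icc (c - δ) (c + δ) ⊆ Icc (c - δ₀) (c + δ₀) :=
    Icc_subset_Icc (by linarith) (by linarith)
  replace hq := hq.restrict hW hW1 (a' := c - δ) (b' := c + δ) (by linarith) (by linarith)
    (by linarith)
  replace hp := hp.restrict (a' := c - δ) (b' := c + δ) (by linarith) (by linarith) (by linarith)
  replace h := h.mono hsub
  set a := c - δ with ha
  set b := c + δ with hb
  have hab : a < b := by linarith
  have hlen : length (riemannNorm (E := E)) p a b = ∫ u in a..b, Real.exp (-σ * u / 2) :=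
    length_eq_integral hp fun t ht hd ↦
      ((h.mono Ioo_subset_Icc_self).speed hW hW1 hσ isOpen_Ioo).2
        (fun s hs hd' ↦ hq.randers_eq_one hW hW1 hs hd') t ht hd
  refine ⟨hp, fun η hη hηa hηb ↦ ?_⟩
  by_contra! hlt
  rw [hlen] at hlt
  -- run through the shorter curve `η` with a speed which is admissible in the moving frame
  obtain ⟨ν, hν, hν'⟩ : ∃ ν > 0, length (riemannNorm (E := E)) η a b + ν * (b - a) <
      ∫ u in a..b, Real.exp (-σ * u / 2) := by
    refine ⟨((∫ u in a..b, Real.exp (-σ * u / 2)) - length (riemannNorm (E := E)) η a b) / 2 /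
      (b - a), div_pos (by linarith) (by linarith), ?_⟩
    rw [div_mul_cancel₀ _ (by linarith)]
    linarith
  have hJ := hη.joins_length isLengthIntegrand_riemannNorm hν
  rw [hηa, hηb] at hJ
  obtain ⟨b', ⟨hab', hb'b⟩, γ, hγ, hγa, hγb, hγv⟩ := hJ.exists_curve_exp hab.le hν'
  have hγlen : length (riemannNorm (E := E)) γ a b' < ρ := by
    refine (length_le_integral isLengthIntegrand_riemannNorm hγ (hg.intervalIntegrable _ _)
      hγv).trans_lt (lt_of_le_of_lt ?_ hρ')
    exact (integral_exp_mul_div_two σ a).2.1.monotone hb'b.le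
  have hγU := hUV γ a b' hγ (hγa ▸ hV') hγlen
  have hγD : ∀ t ∈ Icc a b', (t, γ t) ∈ flowDomain W := fun t ht ↦
    hκU t ⟨by linarith [ht.1], by linarith [ht.2]⟩ _ (hγU t ht)
  have hdr := isDragged_flow hγD
  have htraj : HasVelocityIn (fun x v ↦ randers W x v ≤ 1) (fun t ↦ flow W t (γ t)) a b' := by
    refine ⟨hdr.isPiecewiseC1 hW hγ, ?_⟩
    filter_upwards [hγv, hγ.eventually_mdifferentiableAt] with t ht1 ht2 htI
    have h1 := ht1 htI
    rw [hdr.norm_velocity hW hσ (Icc_mem_nhds htI.1 htI.2) (ht2 htI)] at h1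
    exact (randers_le_one_iff hW1).2 ((mul_le_iff_le_one_right (Real.exp_pos _)).1 h1)
  -- the end point `p b` is reached at time `b'`, and the remaining drift is done at double speed
  have hdrift := joins_flow hW hW1 (x := p b) hb'b.le fun t ht ↦
    hκU t ⟨by linarith [ht.1], by linarith [ht.2]⟩ _ (hγb ▸ hγU b' ⟨hab', le_rfl⟩)
  have hstart := htraj.joins
  simp only [hγa, hγb] at hstart
  have hjoin := hstart.trans hdrift
  rw [(h a ⟨le_rfl, hab.le⟩).2, (h b ⟨hab.le, le_rfl⟩).2] at hjoin
  have := ((isTimeMinimizing_iff hW hW1).1 hq).2 _ hjoin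
  linarith

/-- Dragged by the wind, Riemannian geodesics of the right speed minimise time locally. -/
lemma IsDragged.exists_isTimeMinimizing
    (hW : ContMDiff 𝓘(ℝ, E) 𝓘(ℝ, E).tangent ∞ (fun x ↦ (⟨x, W x⟩ : TangentBundle 𝓘(ℝ, E) M)))
    (hW1 : ∀ x, ‖W x‖ < 1) (hσ : IsInfinitesimalHomothety W σ) {δ₀ : ℝ} (hδ₀ : 0 < δ₀)
    (h : IsDragged W p q (Icc (c - δ₀) (c + δ₀)))
    (hp : IsLengthMinimizing (riemannNorm (E := E)) p (c - δ₀) (c + δ₀))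
    (hv : HasSpeedOn (riemannNorm (E := E)) p (fun t ↦ Real.exp (-σ * t / 2))
      (Ioo (c - δ₀) (c + δ₀))) :
    ∃ δ > 0, δ ≤ δ₀ ∧ IsTimeMinimizing W q (c - δ) (c + δ) := by
  have hg := continuous_exp_mul_div_two σ
  have hWn := contMDiff_neg_field hW
  have hq : IsPiecewiseC1 E q (c - δ₀) (c + δ₀) := h.isPiecewiseC1 hW hp.1
  obtain ⟨κ, hκ, U, hU, hκU⟩ := exists_forall_mem_flowDomain hWn
    (h.symm hW c ⟨by linarith, by linarith⟩).1
  obtain ⟨ρ, hρ, V, hV, hUV⟩ := exists_forall_mem_of_length_lt (E := E) hU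
  -- `δ` is taken so small that the competing trajectories, which have speed at most `2`, stay in `U`,
  -- where the flow is defined at all times of the interval
  have e1 : ∀ᶠ δ in 𝓝 (0 : ℝ), q (c - δ) ∈ V := by
    have h1 : ContinuousAt (fun δ : ℝ ↦ c - δ) 0 := by fun_prop
    have h2 := hq.continuousAt (t := c) ⟨by linarith, by linarith⟩
    rw [← sub_zero c] at h2
    have h3 : Tendsto (fun δ : ℝ ↦ q (c - δ)) (𝓝 0) (𝓝 (q (c - 0))) := h2.comp h1
    rw [sub_zero] at h3
    exact h3 hV
  obtain ⟨δ, ⟨hV', hρ', hδκ, hδδ₀⟩, hδ⟩ := ((e1.and ((eventually_lt_nhds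
    (show 0 < ρ / 4 by positivity)).and ((eventually_lt_nhds hκ).and
    (eventually_le_nhds hδ₀)))).filter_mono nhdsWithin_le_nhds |>.and
      (eventually_mem_nhdsWithin (a := (0 : ℝ)) (s := Ioi 0))).exists
  rw [mem_Ioi] at hδ
  refine ⟨δ, hδ, hδδ₀, ?_⟩
  have hsub : Icc (c - δ) (c + δ) ⊆ Icc (c - δ₀) (c + δ₀) :=
    Icc_subset_Icc (by linarith) (by linarith)
  have hsub' : Ioo (c - δ) (c + δ) ⊆ Ioo (c - δ₀) (c + δ₀) :=
    Ioo_subset_Ioo (by linarith) (by linarith)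
  replace hp := hp.restrict isLengthIntegrand_riemannNorm (a' := c - δ) (b' := c + δ)
    (by linarith) (by linarith) (by linarith)
  replace hq := hq.restrict (a' := c - δ) (b' := c + δ) (by linarith) (by linarith) (by linarith)
  replace h := h.mono hsub
  replace hv : HasSpeedOn _ p _ _ := fun t ht ↦ hv t (hsub' ht)
  set a := c - δ with ha
  set b := c + δ with hb
  have hab : a < b := by linarith
  have hlen : length (riemannNorm (E := E)) p a b = ∫ u in a..b, Real.exp (-σ * u / 2) :=
    length_eq_integral hp.1 hv
  have hqv := ((h.mono Ioo_subset_Icc_self).speed hW hW1 hσ isOpen_Ioo).1 hv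
  rw [isTimeMinimizing_iff hW hW1]
  refine ⟨⟨hq, ?_⟩, fun T hT ↦ ?_⟩
  · filter_upwards [hq.eventually_mdifferentiableAt] with t ht htI
    exact (hqv t htI (ht htI)).le
  by_contra! hlt
  -- the faster trajectory, followed by waiting at the end point
  have hT0 := hT.nonneg
  obtain ⟨γ₀, hγ₀, hγ₀a, hγ₀b⟩ := hT.exists_curve a
  have hwait : HasVelocityIn (fun x v ↦ randers W x v ≤ 1) (fun _ ↦ q b) (a + T) b := by
    refine .const ?_ (by linarith)
    rw [randers_le_one_iff hW1, zero_sub, norm_neg]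
    exact (hW1 _).le
  have hγ := hγ₀.glue hwait hγ₀b
  have hγeq : EqOn (glue (a + T) γ₀ fun _ ↦ q b) (fun _ ↦ q b) (Ici (a + T)) :=
    glue_eqOn_right hγ₀b
  have hγa : glue (a + T) γ₀ (fun _ ↦ q b) a = q a :=
    (glue_eqOn_left (show a ≤ a + T by linarith)).trans hγ₀a
  have hγb : glue (a + T) γ₀ (fun _ ↦ q b) b = q b := hγeq (show a + T ≤ b by linarith)
  set γ := glue (a + T) γ₀ fun _ ↦ q b with hγdef
  have hγlen : length (riemannNorm (E := E)) γ a b < ρ := by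
    have h1 : length (riemannNorm (E := E)) γ a b ≤ ∫ u in a..b, (2 : ℝ) := by
      refine length_le_integral isLengthIntegrand_riemannNorm hγ.1 intervalIntegrable_const ?_
      filter_upwards [hγ.2] with t ht htI
      have h1 := (randers_le_one_iff hW1).1 (ht htI)
      have h2 := norm_le_norm_sub_add (velocity (E := E) γ t) (W (γ t))
      rw [riemannNorm]
      linarith [hW1 (γ t)]
    rw [intervalIntegral.integral_const, smul_eq_mul] at h1
    linarith
  have hγU := hUV γ a b hγ.1 (hγa ▸ hV') hγlen
  have hγD : ∀ t ∈ Icc a b, (t, γ t) ∈ flowDomain (-W) := fun t ht ↦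
    hκU t ⟨by linarith [ht.1], by linarith [ht.2]⟩ _ (hγU t ht)
  set η : ℝ → M := fun t ↦ flow (-W) t (γ t) with hη
  have hdr' : IsDragged (-W) γ η (Icc a b) := isDragged_flow hγD
  have hdr : IsDragged W η γ (Icc a b) := hdr'.of_neg hW
  have hηpw : IsPiecewiseC1 E η a b := hdr'.isPiecewiseC1 hWn hγ.1
  have hηa : η a = p a := by
    rw [hη]; simp only; rw [hγa]; exact (h.symm hW a ⟨le_rfl, hab.le⟩).2
  have hηb : η b = p b := by
    rw [hη]; simp only; rw [hγb]; exact (h.symm hW b ⟨hab.le, le_rfl⟩).2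
  have haT : a ≤ a + T := by linarith
  have hTb : a + T ≤ b := by linarith
  have hηd := hηpw.eventually_mdifferentiableAt
  have hlen1 : length (riemannNorm (E := E)) η a (a + T) ≤
      ∫ u in a..(a + T), Real.exp (-σ * u / 2) := by
    refine length_le_integral isLengthIntegrand_riemannNorm (hηpw.restrict le_rfl haT hTb)
      (hg.intervalIntegrable _ _) ?_
    filter_upwards [hηd, hγ.2] with t ht1 ht2 htI
    have htI' : t ∈ Ioo a b := ⟨htI.1, htI.2.trans_le hTb⟩
    rw [riemannNorm, hdr.norm_velocity hW hσ (Icc_mem_nhds htI'.1 htI'.2) (ht1 htI')]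
    exact mul_le_of_le_one_right (Real.exp_pos _).le ((randers_le_one_iff hW1).1 (ht2 htI'))
  have hlen2 : length (riemannNorm (E := E)) η (a + T) b ≤
      ∫ u in (a + T)..b, Real.exp (-σ * u / 2) * ‖W (q b)‖ := by
    refine length_le_integral isLengthIntegrand_riemannNorm (hηpw.restrict haT hTb le_rfl)
      ((hg.mul continuous_const).intervalIntegrable _ _) ?_
    filter_upwards [hηd] with t ht1 htI
    have htI' : t ∈ Ioo a b := ⟨haT.trans_lt htI.1, htI.2⟩
    rw [riemannNorm, hdr.norm_velocity hW hσ (Icc_mem_nhds htI'.1 htI'.2) (ht1 htI')]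
    have h3 : ‖velocity (E := E) γ t - W (γ t)‖ =
        ‖velocity (E := E) (fun _ : ℝ ↦ q b) t - W (q b)‖ :=
      congrArg (fun z : TangentBundle 𝓘(ℝ, E) M ↦ ‖z.2 - W z.1‖)
        (velocity_congr (hγeq.eventuallyEq_of_mem (Ici_mem_nhds htI.1)))
    rw [h3, velocity_const, zero_sub, norm_neg]
  have hmin := hp.2 η hηpw hηa hηb
  rw [← length_add isLengthIntegrand_riemannNorm (hηpw.restrict le_rfl haT hTb)
    (hηpw.restrict haT hTb le_rfl), hlen,
    ← intervalIntegral.integral_add_adjacent_intervals (hg.intervalIntegrable a (a + T))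
      (hg.intervalIntegrable (a + T) b)] at hmin
  rw [intervalIntegral.integral_mul_const] at hlen2
  have hpos : 0 < ∫ u in (a + T)..b, Real.exp (-σ * u / 2) :=
    intervalIntegral.intervalIntegral_pos_of_pos (hg.intervalIntegrable _ _)
      (fun _ ↦ Real.exp_pos _) (by linarith)
  nlinarith [hW1 (q b)]

lemma exists_Icc_subset (hJ : IsOpen J) (hc : c ∈ J) {δ₁ : ℝ} (hδ₁ : 0 < δ₁) :
    ∃ δ > 0, δ ≤ δ₁ ∧ Icc (c - δ) (c + δ) ⊆ J := by
  obtain ⟨δ, hδ, hδJ⟩ := Metric.nhds_basis_closedBall.mem_iff.1 (hJ.mem_nhds hc)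
  rw [Real.closedBall_eq_Icc] at hδJ
  refine ⟨min δ δ₁, lt_min hδ hδ₁, min_le_right _ _, (Icc_subset_Icc ?_ ?_).trans hδJ⟩ <;>
    linarith [min_le_left δ δ₁]

theorem IsDragged.isGeodesicOn
    (hW : ContMDiff 𝓘(ℝ, E) 𝓘(ℝ, E).tangent ∞ (fun x ↦ (⟨x, W x⟩ : TangentBundle 𝓘(ℝ, E) M)))
    (hW1 : ∀ x, ‖W x‖ < 1) (hσ : IsInfinitesimalHomothety W σ) (h : IsDragged W p q J)
    (hq : IsLocallyTimeMinimizingOn W q J) :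
    IsGeodesicOn (riemannNorm (E := E)) p J := by
  intro c hc
  obtain ⟨δ₀, hδ₀, hJ₀, hm⟩ := hq c hc
  obtain ⟨δ, hδ, hδ', hmin⟩ := (h.mono hJ₀).exists_isLengthMinimizing hW hW1 hσ hδ₀ hm
  exact ⟨δ, hδ, (Icc_subset_Icc (by linarith) (by linarith)).trans hJ₀, hmin⟩

theorem IsDragged.isLocallyTimeMinimizingOn
    (hW : ContMDiff 𝓘(ℝ, E) 𝓘(ℝ, E).tangent ∞ (fun x ↦ (⟨x, W x⟩ : TangentBundle 𝓘(ℝ, E) M)))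
    (hW1 : ∀ x, ‖W x‖ < 1) (hσ : IsInfinitesimalHomothety W σ) (h : IsDragged W p q J)
    (hp : IsGeodesicOn (riemannNorm (E := E)) p J)
    (hv : HasSpeedOn (riemannNorm (E := E)) p (fun t ↦ Real.exp (-σ * t / 2)) J) :
    IsLocallyTimeMinimizingOn W q J := by
  intro c hc
  obtain ⟨δ₀, hδ₀, hJ₀, hm⟩ := hp c hc
  obtain ⟨δ, hδ, hδ', hmin⟩ := (h.mono hJ₀).exists_isTimeMinimizing hW hW1 hσ hδ₀ hm
    fun t ht ↦ hv t (hJ₀ (Ioo_subset_Icc_self ht))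
  exact ⟨δ, hδ, (Icc_subset_Icc (by linarith) (by linarith)).trans hJ₀, hmin⟩

lemma IsGeodesicOn.mono {F : (x : M) → TangentSpace 𝓘(ℝ, E) x → ℝ} (hF : IsLengthIntegrand F)
    {J' : Set ℝ} (h : IsGeodesicOn F p J) (hJ' : IsOpen J') (hJJ' : J' ⊆ J) :
    IsGeodesicOn F p J' := by
  intro c hc
  obtain ⟨δ₀, hδ₀, -, hm⟩ := h c (hJJ' hc)
  obtain ⟨δ, hδ, hle, hδJ⟩ := exists_Icc_subset hJ' hc hδ₀
  exact ⟨δ, hδ, hδJ, hm.restrict hF (by linarith) (by linarith) (by linarith)⟩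

lemma IsLocallyTimeMinimizingOn.mono
    (hW : ContMDiff 𝓘(ℝ, E) 𝓘(ℝ, E).tangent ∞ (fun x ↦ (⟨x, W x⟩ : TangentBundle 𝓘(ℝ, E) M)))
    (hW1 : ∀ x, ‖W x‖ < 1) {J' : Set ℝ} (h : IsLocallyTimeMinimizingOn W q J)
    (hJ' : IsOpen J') (hJJ' : J' ⊆ J) : IsLocallyTimeMinimizingOn W q J' := by
  intro c hc
  obtain ⟨δ₀, hδ₀, -, hm⟩ := h c (hJJ' hc)
  obtain ⟨δ, hδ, hle, hδJ⟩ := exists_Icc_subset hJ' hc hδ₀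
  exact ⟨δ, hδ, hδJ, hm.restrict hW hW1 (by linarith) (by linarith) (by linarith)⟩

end Zermelo

end

theorem theorem1 {E : Type*} [NormedAddCommGroup E] [NormedSpace ℝ E] [FiniteDimensional ℝ E]
    {M : Type*} [TopologicalSpace M] [T2Space M] [ChartedSpace E M] [IsManifold 𝓘(ℝ, E) ∞ M]
    [RiemannianBundle (fun x : M ↦ TangentSpace 𝓘(ℝ, E) x)]
    [IsContMDiffRiemannianBundle 𝓘(ℝ, E) ∞ E (fun x : M ↦ TangentSpace 𝓘(ℝ, E) x)]
    (W : (x : M) → TangentSpace 𝓘(ℝ, E) x)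
    (hW : ContMDiff 𝓘(ℝ, E) 𝓘(ℝ, E).tangent ∞ (fun x ↦ (⟨x, W x⟩ : TangentBundle 𝓘(ℝ, E) M)))
    (hW1 : ∀ x, ‖W x‖ < 1)
    (σ : ℝ) (hσ : Zermelo.IsInfinitesimalHomothety W σ)
    (ε : ℝ) (hε : 0 < ε) :
    -- from locally time-minimising curves to Riemannian geodesics
    (∀ q : ℝ → M, Zermelo.IsLocallyTimeMinimizingOn W q (Set.Ioo (-ε) ε) →
      (∃ r : ℝ, 0 < r ∧ r ≤ ε ∧ ∀ t ∈ Set.Ioo (-r) r, (t, q t) ∈ Zermelo.flowDomain (-W)) ∧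
      ∀ r : ℝ, 0 < r → r ≤ ε → (∀ t ∈ Set.Ioo (-r) r, (t, q t) ∈ Zermelo.flowDomain (-W)) →
        Zermelo.IsGeodesicOn (Zermelo.riemannNorm (E := E) (M := M))
          (fun t ↦ Zermelo.flow (-W) t (q t)) (Set.Ioo (-r) r) ∧
        Zermelo.HasSpeedOn (Zermelo.riemannNorm (E := E) (M := M)) (fun t ↦ Zermelo.flow (-W) t (q t))
          (fun t ↦ Real.exp (-σ * t / 2)) (Set.Ioo (-r) r)) ∧
    -- from Riemannian geodesics to locally time-minimising curves
    (∀ p : ℝ → M, Zermelo.IsGeodesicOn (Zermelo.riemannNorm (E := E) (M := M)) p (Set.Ioo (-ε) ε) →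
      Zermelo.HasSpeedOn (Zermelo.riemannNorm (E := E) (M := M)) p (fun t ↦ Real.exp (-σ * t / 2)) (Set.Ioo (-ε) ε) →
      (∃ r : ℝ, 0 < r ∧ r ≤ ε ∧ ∀ t ∈ Set.Ioo (-r) r, (t, p t) ∈ Zermelo.flowDomain W) ∧
      ∀ r : ℝ, 0 < r → r ≤ ε → (∀ t ∈ Set.Ioo (-r) r, (t, p t) ∈ Zermelo.flowDomain W) →
        Zermelo.IsLocallyTimeMinimizingOn W
          (fun t ↦ Zermelo.flow W t (p t)) (Set.Ioo (-r) r)) ∧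
    -- locally time-minimising curves are the Randers geodesics in physical parametrisation
    (∀ q : ℝ → M, Zermelo.IsLocallyTimeMinimizingOn W q (Set.Ioo (-ε) ε) ↔
      Zermelo.IsGeodesicOn (Zermelo.randers W) q (Set.Ioo (-ε) ε) ∧
        Zermelo.HasSpeedOn (Zermelo.randers W) q (fun _ ↦ 1) (Set.Ioo (-ε) ε)) := by
  have h0 : (0 : ℝ) ∈ Set.Ioo (-ε) ε := ⟨neg_lt_zero.2 hε, hε⟩
  have hsub : ∀ r ≤ ε, Set.Ioo (-r) r ⊆ Set.Ioo (-ε) ε := fun r hr ↦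
    Set.Ioo_subset_Ioo (neg_le_neg hr) hr
  refine ⟨fun q hq ↦ ⟨?_, fun r _ hrε hD ↦ ?_⟩, fun p hp hv ↦ ⟨?_, fun r _ hrε hD ↦ ?_⟩,
    fun q ↦ Zermelo.isLocallyTimeMinimizingOn_iff hW hW1⟩
  · obtain ⟨δ, hδ, -, hm⟩ := hq 0 h0
    exact Zermelo.exists_forall_mem_flowDomain_of_continuousAt (Zermelo.contMDiff_neg_field hW)
      (hm.1.1.continuousAt ⟨by linarith, by linarith⟩) hε
  · have hdr := (Zermelo.isDragged_flow hD).of_neg hW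
    have hq' := hq.mono hW hW1 isOpen_Ioo (hsub r hrε)
    exact ⟨hdr.isGeodesicOn hW hW1 hσ hq', (hdr.speed hW hW1 hσ isOpen_Ioo).2
      ((Zermelo.isLocallyTimeMinimizingOn_iff hW hW1).1 hq').2⟩
  · obtain ⟨δ, hδ, -, hm⟩ := hp 0 h0
    exact Zermelo.exists_forall_mem_flowDomain_of_continuousAt hW
      (hm.1.continuousAt ⟨by linarith, by linarith⟩) hε
  · exact (Zermelo.isDragged_flow hD).isLocallyTimeMinimizingOn hW hW1 hσ
      (hp.mono Zermelo.isLengthIntegrand_riemannNorm isOpen_Ioo (hsub r hrε))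
      fun t ht ↦ hv t (hsub r hrε ht)
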